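/- Let $w>0$, $\mu\ge 0$, $L\ge 2$. Diffusion-limited pair annihilation and deposition on the torus $\mathbb Z/L\mathbb Z$ with jump rate $w$ and deposition rate $\mu$, together with its activity, is the continuous-time Markov chain $(\eta(t),A(t))$ on $\{0,1\}^{\mathbb Z/L\mathbb Z}\times\mathbb N_0$ with generator $$(\tilde{\mathcal H}f)(\eta,A)=\sum_{k\in\mathbb Z/L\mathbb Z}\Big[\mu f(\bar\eta^{k},A)+w(\eta_k+\eta_{k+1})f(\bar\eta^{k},A+1)-\big(\mu+w(\eta_k+\eta_{k+1})\big)f(\eta,A)\Big],$$ where $\bar\eta^{k}$ is $\eta$ with the occupation numbers at sites $k$ and $k+1$ both flipped ($0\leftrightarrow1$). The parity of the particle number $\sum_k\eta_k$ is conserved. Write $\mathbb E_{\eta}$ for the expectation of the process started in $(\eta,0)$. Take $w=\tfrac12$ and $\mu=\tfrac{1-\nu}{2}$ with $0\le\nu\le1$, and let $s_c=\ln(1-\mu/w)=\ln\nu$ (for $\nu=0$: $s_c=-\infty$, with $\mathrm e^{s_cA}=1$ if $A=0$ and $\mathrm e^{s_cA}=0$ if $A\ge1$). **Proposition.** Fix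 $\nu\in[0,1]$. For every $L\ge2$ the limiting cumulant generating function of the activity per site and unit time at the critical point $s_c$, $$K_L^{\pm}(s_c)=\lim_{t\to\infty}\frac1{Lt}\ln\mathbb E_\eta\big[\mathrm e^{s_cA(t)}\big],$$ exists and takes the same value for all initial configurations $\eta$ with an even ($+$), respectively odd ($-$), number of particles; and, as $L\to\infty$, $$K_L^{+}(s_c)=\kappa_0^*+\frac1\xi\,\frac{\pi c}{6L^2}+O(L^{-4}),\qquad K_L^{-}(s_c)=\kappa_0^*-\frac1\xi\,\frac{\pi c}{3L^2}+O(L^{-3}),$$ where the implied constants may depend on $\nu$, and $$\kappa_0^*=\frac\nu2-1+\frac1\pi\Big(\frac{\arcsin\nu}{\nu}+\sqrt{1-\nu^2}\Big),\qquad \xi=\frac1{\sqrt{1-\nu^2}},\qquad c=\frac12,$$ with the limit values $\frac{\arcsin\nu}{\nu}=1$ at $\nu=0$ and $\frac1\xi=0$ at $\nu=1$. -/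

import Mathlib

open Filter Topology Asymptotics

namespace DLPAD

noncomputable section

/-- Configurations of at most one particle per site on the discrete torus `ℤ / Lℤ`;
`η k = true` means that site `k` is occupied. -/
abbrev Config (L : ℕ) : Type := Fin L → Bool

/-- The occupation number `η_k ∈ {0, 1}`. -/
def occ {L : ℕ} (η : Config L) (k : Fin L) : ℕ := if η k then 1 else 0

/-- The total particle number `N(η)`. -/
def particleNumber {L : ℕ} (η : Config L) : ℕ := ∑ k, occ η k

/-- The configuration in which the two sites `k` and `k + 1` (modulo `L`) are flipped;
`finRotate L` is the map `k ↦ k + 1` modulo `L`. -/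
def flip {L : ℕ} (η : Config L) (k : Fin L) : Config L :=
  fun j => if j = k ∨ j = finRotate L k then !(η j) else η j

/-- States `(η, A)` of the joint process of the configuration and the activity. -/
abbrev JointState (L : ℕ) : Type := Config L × ℕ

/-- The generator of the joint process with jump rate `w` and deposition rate `μ`: the bond
`(k, k + 1)` is flipped with rate `μ` without change of the activity, and with rate
`w (η_k + η_{k+1})` with an increment of the activity by `1`. -/
def jointGenerator (L : ℕ) (w μ : ℝ) : (JointState L → ℝ) →ₗ[ℝ] (JointState L → ℝ) where
  toFun f x := ∑ k : Fin L,
    (μ * f (flip x.1 k, x.2)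
      + w * ((occ x.1 k : ℝ) + occ x.1 (finRotate L k)) * f (flip x.1 k, x.2 + 1)
      - (μ + w * ((occ x.1 k : ℝ) + occ x.1 (finRotate L k))) * f x)
  map_add' f g := by
    funext x
    simp only [Pi.add_apply, ← Finset.sum_add_distrib]
    exact Finset.sum_congr rfl fun k _ => by ring
  map_smul' c f := by
    funext x
    simp only [Pi.smul_apply, smul_eq_mul, RingHom.id_apply, Finset.mul_sum]
    exact Finset.sum_congr rfl fun k _ => by ring

/-- The transition probability `p_t(x, y) = (exp (t 𝓖) 1_{y}) (x)` of the joint process. The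
rates are bounded, so that the exponential series converges absolutely. -/
def transitionProb (L : ℕ) (w μ t : ℝ) (x y : JointState L) : ℝ :=
  ∑' n : ℕ, t ^ n / (n.factorial : ℝ) * ((jointGenerator L w μ ^ n) (Pi.single y 1)) x

/-- The moment generating function `𝔼_{η,0} [exp (s A(t))]` of the activity at time `t`, started
from the configuration `η` with activity `0`. The Legendre parameter `s` may be `-∞ = ⊥`, with
`exp (-∞ * A) = 1` if `A = 0` and `0` if `A ≥ 1`. -/
def activityMGF (L : ℕ) (w μ : ℝ) (η : Config L) (s : EReal) (t : ℝ) : ℝ :=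
  ∑' y : JointState L,
    transitionProb L w μ t (η, 0) y * (EReal.exp (s * (y.2 : EReal))).toReal

/-- `κ` is the limiting cumulant generating function per site and unit time,
`lim_{t → ∞} (1 / (L t)) log 𝔼_{η,0} [exp (s A(t))]`, for every initial configuration `η`
whose particle number has the parity `sector` (`Even` or `Odd`). -/
def IsCumulantGF (L : ℕ) (w μ : ℝ) (s : EReal) (sector : ℕ → Prop) (κ : ℝ) : Prop :=
  ∀ η : Config L, sector (particleNumber η) →
    Tendsto (fun t : ℝ => Real.log (activityMGF L w μ η s t) / (L * t)) atTop (𝓝 κ)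

/-- The critical point `s_c = log (1 - μ / w)`, equal to `-∞` for `μ = w`. -/
def criticalPoint (w μ : ℝ) : EReal := ENNReal.log (ENNReal.ofReal (1 - μ / w))

/-- `κ*_0 = ν / 2 - 1 + (arcsin ν / ν + √(1 - ν²)) / π`, where `arcsin ν / ν` takes its limit
value `1` at `ν = 0`. -/
def kappaStar (ν : ℝ) : ℝ :=
  ν / 2 - 1 + 1 / Real.pi *
    ((if ν = 0 then 1 else Real.arcsin ν / ν) + Real.sqrt (1 - ν ^ 2))

/-- The sound velocity `ξ = 1 / √(1 - ν²)`. It enters only through `1 / ξ`, which is `√(1 - ν²)`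
for all `0 ≤ ν ≤ 1`, including the value `0` at `ν = 1`, where `ξ` is infinite. -/
def soundVelocity (ν : ℝ) : ℝ := 1 / Real.sqrt (1 - ν ^ 2)

/-- The central charge of the Ising universality class. -/
def centralCharge : ℝ := 1 / 2

end

end DLPAD

namespace DLPAD

/-! ### Feynman–Kac reduction to a semigroup on configurations -/

noncomputable section

/-! With `a = exp s`, the joint generator sends `h(η) a^A` to `(H_a h)(η) a^A` for the tilted
generator `H_a`, so the moment generating function is `(exp(t H_a) 1)(η)`. The critical point is `a
= ν`. For `ν < 1` a weight `d` per particle makes `H_ν` symmetric: a bond is flipped with rate `1/2`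
or `γ/2`, `γ = √(1 - ν²)`, and the diagonal is affine in the particle number. The rates are positive
and the flips act transitively on each parity sector, so Perron–Frobenius gives a positive
eigenvector whose eigenvalue `Λ` is both the exponential growth rate and the maximum of the
quadratic form on the sector.

On a sector, Jordan–Wigner writes the symmetrized generator plus `L (1 - ν/2)` as `∑ M j l B_j A_l`
in Majorana operators. The matrix `M` is translation invariant, antiperiodic for even and periodic
for odd parity. Over all unit vectors such a form has maximum the trace norm of `M`: Cauchy–Schwarz
bounds it (`form_le`), and a common kernel vector of annihilators built from the polar factor of `M`
attains it (`exists_form_eq`). In Fourier space the trace norm is the sum of the dispersion relation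
over the allowed momenta.

The maximizer must also lie in the right sector, but its parity is never computed. In the periodic
case the constant vector is a zero mode of `M`, which expresses criticality, and the zero mode
switches the parity at no cost (`exists_form_eq_swap`). In the antiperiodic case a maximizer of odd
parity would, by the diamagnetic inequality, force the antiperiodic sum to be at most the periodic
one. For large `L` the asymptotics exclude this, and large `L` is all that the expansion needs.

The two sums are the midpoint and the trapezoidal rule for `g(x) = sin(πx) √(1 - ν² cos²(πx))` on
`[0, 1]`. The integral of `g` is `κ*_0 + 1 - ν/2`, and Euler–Maclaurin with `g'(1) - g'(0) = -2π√(1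
- ν²)` gives both `L⁻²` terms. At `ν = 1` there is no tilt and everything vanishes. -/

/-- The tilted generator with weight `a` for every jump that increases the activity. -/
def tiltedGenerator (L : ℕ) (w μ a : ℝ) : (Config L → ℝ) →ₗ[ℝ] (Config L → ℝ) where
  toFun f η := ∑ k : Fin L,
    ((μ + w * a * ((occ η k : ℝ) + occ η (finRotate L k))) * f (flip η k)
      - (μ + w * ((occ η k : ℝ) + occ η (finRotate L k))) * f η)
  map_add' f g := by
    funext x
    simp only [Pi.add_apply, ← Finset.sum_add_distrib]
    exact Finset.sum_congr rfl fun k _ => by ring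
  map_smul' c f := by
    funext x
    simp only [Pi.smul_apply, smul_eq_mul, RingHom.id_apply, Finset.mul_sum]
    exact Finset.sum_congr rfl fun k _ => by ring

lemma jointGenerator_apply (L : ℕ) (w μ : ℝ) (f : JointState L → ℝ) (x : JointState L) :
    jointGenerator L w μ f x = ∑ k : Fin L,
    (μ * f (flip x.1 k, x.2)
      + w * ((occ x.1 k : ℝ) + occ x.1 (finRotate L k)) * f (flip x.1 k, x.2 + 1)
      - (μ + w * ((occ x.1 k : ℝ) + occ x.1 (finRotate L k))) * f x) := rfl

lemma tiltedGenerator_apply (L : ℕ) (w μ a : ℝ) (f : Config L → ℝ) (η : Config L) :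
    tiltedGenerator L w μ a f η = ∑ k : Fin L,
    ((μ + w * a * ((occ η k : ℝ) + occ η (finRotate L k))) * f (flip η k)
      - (μ + w * ((occ η k : ℝ) + occ η (finRotate L k))) * f η) := rfl

/-- Each power of the generator reads a function at finitely many states only, so its kernel
represents it on every `f`, bounded or not. -/
lemma jointGenerator_pow_hasSum (L : ℕ) (w μ : ℝ) (n : ℕ) (f : JointState L → ℝ)
    (x : JointState L) :
    HasSum (fun y => ((jointGenerator L w μ ^ n) (Pi.single y 1)) x * f y)
      ((jointGenerator L w μ ^ n) f x) := by
  induction n generalizing x with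
  | zero =>
    have h := hasSum_single (f := fun y => (Pi.single y (1 : ℝ) : JointState L → ℝ) x * f y) x
      (fun y hy => by simp [Pi.single_eq_of_ne hy.symm])
    simpa using h
  | succ n ih =>
    simp only [pow_succ', Module.End.mul_apply]
    simp only [jointGenerator_apply L w μ ((jointGenerator L w μ ^ n) _)]
    simp only [Finset.sum_mul]
    refine hasSum_sum fun k _ => ?_
    have h := (((ih (flip x.1 k, x.2)).mul_left μ).add
      ((ih (flip x.1 k, x.2 + 1)).mul_left
        (w * ((occ x.1 k : ℝ) + occ x.1 (finRotate L k))))).sub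
      ((ih x).mul_left (μ + w * ((occ x.1 k : ℝ) + occ x.1 (finRotate L k))))
    refine Eq.mp (congrArg (HasSum · _) (funext fun y => ?_)) h
    ring

lemma occ_le_one {L : ℕ} (η : Config L) (k : Fin L) : (occ η k : ℝ) ≤ 1 := by
  unfold occ; split_ifs <;> simp

/-- A bond contributes at most `μ + 2w` through its jumps and `μ + 2w` through its diagonal term,
which bounds the absolute row sums geometrically. -/
lemma jointGenerator_pow_abs (L : ℕ) {w μ : ℝ} (hw : 0 ≤ w) (hμ : 0 ≤ μ) (n : ℕ)
    (x : JointState L) :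
    Summable (fun y => |((jointGenerator L w μ ^ n) (Pi.single y 1)) x|) ∧
      ∑' y, |((jointGenerator L w μ ^ n) (Pi.single y 1)) x| ≤ (L * (2 * μ + 4 * w)) ^ n := by
  induction n generalizing x with
  | zero =>
    have h := hasSum_single (f := fun y => |(Pi.single y (1 : ℝ) : JointState L → ℝ) x|) x
      (fun y hy => by simp [Pi.single_eq_of_ne hy.symm])
    have h' : HasSum (fun y => |((jointGenerator L w μ ^ 0) (Pi.single y 1)) x|) 1 := by
      simpa using h
    exact ⟨h'.summable, by rw [h'.tsum_eq]; simp⟩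
  | succ n ih =>
    set p : JointState L → JointState L → ℝ :=
      fun x y => |((jointGenerator L w μ ^ n) (Pi.single y 1)) x| with hp
    set c : ℝ := (L * (2 * μ + 4 * w)) ^ n
    have hs : ∀ x, HasSum (p x) (∑' y, p x y) := fun x => (ih x).1.hasSum
    have hle : ∀ y, |((jointGenerator L w μ ^ (n + 1)) (Pi.single y 1)) x| ≤
        ∑ k : Fin L, (μ * p (flip x.1 k, x.2) y + (2 * w) * p (flip x.1 k, x.2 + 1) y
          + (μ + 2 * w) * p x y) := by
      intro y
      rw [pow_succ', Module.End.mul_apply, jointGenerator_apply]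
      refine (Finset.abs_sum_le_sum_abs _ _).trans (Finset.sum_le_sum fun k _ => ?_)
      have h0 : (0 : ℝ) ≤ (occ x.1 k : ℝ) + occ x.1 (finRotate L k) := by positivity
      have h2 : (occ x.1 k : ℝ) + occ x.1 (finRotate L k) ≤ 2 := by
        linarith [occ_le_one x.1 k, occ_le_one x.1 (finRotate L k)]
      refine (abs_sub _ _).trans (add_le_add ((abs_add_le _ _).trans (add_le_add ?_ ?_)) ?_)
      · rw [abs_mul, abs_of_nonneg hμ]
      · rw [abs_mul, abs_of_nonneg (by positivity)]
        exact mul_le_mul_of_nonneg_right (by nlinarith) (abs_nonneg _)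
      · rw [abs_mul, abs_of_nonneg (by positivity)]
        exact mul_le_mul_of_nonneg_right (by nlinarith) (abs_nonneg _)
    have hsum := hasSum_sum (s := Finset.univ) fun (k : Fin L) _ =>
      (((hs (flip x.1 k, x.2)).mul_left μ).add ((hs (flip x.1 k, x.2 + 1)).mul_left (2 * w))).add
        ((hs x).mul_left (μ + 2 * w))
    have hS : Summable (fun y => |((jointGenerator L w μ ^ (n + 1)) (Pi.single y 1)) x|) :=
      Summable.of_nonneg_of_le (fun _ => abs_nonneg _) hle hsum.summable
    refine ⟨hS, (hS.tsum_le_tsum hle hsum.summable).trans ?_⟩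
    rw [hsum.tsum_eq]
    calc _ ≤ ∑ k : Fin L, (μ * c + 2 * w * c + (μ + 2 * w) * c) := by
          refine Finset.sum_le_sum fun k _ => ?_
          have h1 := (ih (flip x.1 k, x.2)).2
          have h2 := (ih (flip x.1 k, x.2 + 1)).2
          have h3 := (ih x).2
          gcongr
      _ = (L * (2 * μ + 4 * w)) ^ (n + 1) := by
          rw [Finset.sum_const, Finset.card_univ, Fintype.card_fin, nsmul_eq_mul, pow_succ]
          simp only [c]; ring

/-- A jump `A ↦ A + 1` multiplies `a ^ A` by `a`, so the activity variable factors out and only the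
tilt remains. -/
lemma jointGenerator_pow_weight (L : ℕ) (w μ a : ℝ) (n : ℕ) (h : Config L → ℝ) :
    (jointGenerator L w μ ^ n) (fun y => h y.1 * a ^ y.2) =
      fun y => (tiltedGenerator L w μ a ^ n) h y.1 * a ^ y.2 := by
  induction n with
  | zero => rfl
  | succ n ih =>
    rw [pow_succ', Module.End.mul_apply, ih, pow_succ', Module.End.mul_apply]
    funext y
    rw [jointGenerator_apply, tiltedGenerator_apply, Finset.sum_mul]
    exact Finset.sum_congr rfl fun k _ => by ring

lemma activityMGF_eq_tsum (L : ℕ) {w μ a : ℝ} (hw : 0 ≤ w) (hμ : 0 ≤ μ) (ha0 : 0 ≤ a)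
    (ha1 : a ≤ 1) (η : Config L) (s : EReal) (hs : EReal.exp s = ENNReal.ofReal a) (t : ℝ) :
    activityMGF L w μ η s t =
      ∑' n : ℕ, t ^ n / (n.factorial : ℝ) * ((tiltedGenerator L w μ a ^ n) (fun _ => 1)) η := by
  have hwt : ∀ A : ℕ, (EReal.exp (s * (A : EReal))).toReal = a ^ A := by
    intro A
    rw [mul_comm, EReal.exp_nmul, hs, ENNReal.toReal_pow, ENNReal.toReal_ofReal ha0]
  unfold activityMGF transitionProb
  simp_rw [hwt, ← tsum_mul_right]
  set F : JointState L → ℕ → ℝ := fun y n =>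
    t ^ n / (n.factorial : ℝ) * ((jointGenerator L w μ ^ n) (Pi.single y 1)) (η, 0) * a ^ y.2
    with hF
  -- Because `0 ≤ a ≤ 1`, the weight `a ^ A` is at most `1`; the row sum bound then permits
  -- exchanging the sum over states with the exponential series.
  have hbound : ∀ n y, ‖F y n‖ ≤ |t| ^ n / (n.factorial : ℝ) *
      |((jointGenerator L w μ ^ n) (Pi.single y 1)) (η, 0)| := by
    intro n y
    rw [hF, Real.norm_eq_abs, abs_mul, abs_mul, abs_div, abs_pow, Nat.abs_cast,
      abs_of_nonneg (pow_nonneg ha0 _)]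
    exact mul_le_of_le_one_right (by positivity) (pow_le_one₀ ha0 ha1)
  have hsumn : ∀ n, Summable fun y => |t| ^ n / (n.factorial : ℝ) *
      |((jointGenerator L w μ ^ n) (Pi.single y 1)) (η, 0)| := fun n =>
    (jointGenerator_pow_abs L hw hμ n (η, 0)).1.mul_left _
  have hsum : Summable (fun p : ℕ × JointState L => F p.2 p.1) := by
    refine Summable.of_norm_bounded (g := fun p : ℕ × JointState L =>
      |t| ^ p.1 / (p.1.factorial : ℝ) *
      |((jointGenerator L w μ ^ p.1) (Pi.single p.2 1)) (η, 0)|) ?_ (fun p => hbound p.1 p.2)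
    rw [summable_prod_of_nonneg (fun p => by positivity)]
    refine ⟨hsumn, ?_⟩
    refine Summable.of_nonneg_of_le (fun n => tsum_nonneg fun y => by positivity) (fun n => ?_)
      (Real.summable_pow_div_factorial (|t| * (L * (2 * μ + 4 * w))))
    dsimp only
    rw [tsum_mul_left, mul_pow]
    have := (jointGenerator_pow_abs L hw hμ n (η, 0)).2
    calc _ ≤ |t| ^ n / (n.factorial : ℝ) * (L * (2 * μ + 4 * w)) ^ n := by gcongr
      _ = _ := by ring
  have := Summable.tsum_comm (f := F) (by
    simpa [Function.uncurry_def] using hsum.prod_symm)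
  refine this.symm.trans ?_
  refine tsum_congr fun n => ?_
  have h := jointGenerator_pow_hasSum L w μ n (fun y => (1 : ℝ) * a ^ y.2) (η, 0)
  rw [jointGenerator_pow_weight L w μ a n (fun _ => 1)] at h
  have h2 := (h.mul_left (t ^ n / (n.factorial : ℝ))).tsum_eq
  simp only [one_mul, pow_zero, mul_one] at h2
  rw [← h2]
  exact tsum_congr fun y => by simp only [hF]; ring

lemma exp_criticalPoint {w μ : ℝ} :
    EReal.exp (criticalPoint w μ) = ENNReal.ofReal (1 - μ / w) := by
  rw [criticalPoint, ENNReal.exp_log]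

/-! ### Growth rate of a positive finite-dimensional semigroup -/

section Semigroup

variable {X : Type*}

lemma pow_congr_on (H : Module.End ℝ (X → ℝ)) (σ : X → Prop)
    (hσ : ∀ f g : X → ℝ, (∀ x, σ x → f x = g x) → ∀ x, σ x → H f x = H g x)
    (n : ℕ) (f g : X → ℝ) (hfg : ∀ x, σ x → f x = g x) : ∀ x, σ x → (H ^ n) f x = (H ^ n) g x := by
  induction n with
  | zero => simpa using hfg
  | succ n ih =>
    rw [pow_succ', Module.End.mul_apply, Module.End.mul_apply]
    exact hσ _ _ ih

variable [Fintype X]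

lemma hasSum_exp_apply (H : Module.End ℝ (X → ℝ)) (t : ℝ) (f : X → ℝ) (x : X) :
    HasSum (fun n : ℕ => t ^ n / (n.factorial : ℝ) * (H ^ n) f x)
      (NormedSpace.exp (t • Module.End.toContinuousLinearMap (X → ℝ) H) f x) := by
  have h := NormedSpace.exp_series_hasSum_exp' (𝕂 := ℝ)
    (t • Module.End.toContinuousLinearMap (X → ℝ) H)
  have h1 := (ContinuousLinearMap.apply ℝ (X → ℝ) f).hasSum h
  have h2 := (ContinuousLinearMap.proj (R := ℝ) (φ := fun _ : X => ℝ) x).hasSum h1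
  refine Eq.mp (congrArg (HasSum · _) (funext fun n => ?_)) h2
  rw [smul_pow, ← map_pow]
  simp only [ContinuousLinearMap.proj_apply, ContinuousLinearMap.apply_apply,
    smul_apply, Pi.smul_apply, smul_eq_mul]
  rw [div_eq_inv_mul, mul_assoc]
  rfl

omit [Fintype X] in
lemma tsum_exp_eigenvector (H : Module.End ℝ (X → ℝ)) (t Λ : ℝ) (v : X → ℝ)
    (hv : H v = Λ • v) (x : X) :
    ∑' n : ℕ, t ^ n / (n.factorial : ℝ) * (H ^ n) v x = Real.exp (t * Λ) * v x := by
  have hp : ∀ n : ℕ, (H ^ n) v = Λ ^ n • v := by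
    intro n
    induction n with
    | zero => simp
    | succ n ih => rw [pow_succ', Module.End.mul_apply, ih, map_smul, hv, smul_smul, pow_succ]
  have h := (NormedSpace.expSeries_div_hasSum_exp (t * Λ)).mul_right (v x)
  rw [← Real.exp_eq_exp_ℝ] at h
  rw [← h.tsum_eq]
  refine tsum_congr fun n => ?_
  rw [hp, Pi.smul_apply, smul_eq_mul, mul_pow]; ring

/-- The shift `K = H + c` preserves positivity, hence so does every term of the series of `exp(tK)`,
and `exp(tH) = exp(-tc) exp(tK)`. -/
lemma tsum_exp_mono (H : Module.End ℝ (X → ℝ)) (c : ℝ)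
    (hH : ∀ f : X → ℝ, 0 ≤ f → 0 ≤ H f + c • f) {t : ℝ} (ht : 0 ≤ t) {f g : X → ℝ}
    (hfg : f ≤ g) (x : X) :
    ∑' n : ℕ, t ^ n / (n.factorial : ℝ) * (H ^ n) f x ≤
      ∑' n : ℕ, t ^ n / (n.factorial : ℝ) * (H ^ n) g x := by
  rw [(hasSum_exp_apply H t f x).tsum_eq, (hasSum_exp_apply H t g x).tsum_eq]
  set K : Module.End ℝ (X → ℝ) := H + c • 1 with hK
  have hpos : ∀ n : ℕ, ∀ h : X → ℝ, 0 ≤ h → 0 ≤ (K ^ n) h := by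
    intro n
    induction n with
    | zero => intro h hh; simpa using hh
    | succ n ih =>
      intro h hh
      rw [pow_succ, Module.End.mul_apply]
      exact ih _ (by simpa [hK] using hH h hh)
  have hexp : NormedSpace.exp (t • Module.End.toContinuousLinearMap (X → ℝ) H) =
      Real.exp (-(t * c)) • NormedSpace.exp (t • Module.End.toContinuousLinearMap (X → ℝ) K) := by
    have h1 : t • Module.End.toContinuousLinearMap (X → ℝ) H =
        algebraMap ℝ _ (-(t * c)) + t • Module.End.toContinuousLinearMap (X → ℝ) K := by
      rw [hK, map_add, map_smul, map_one, Algebra.algebraMap_eq_smul_one, smul_add, smul_smul]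
      module
    let _ : NormedAlgebra ℚ ((X → ℝ) →L[ℝ] (X → ℝ)) := NormedAlgebra.restrictScalars ℚ ℝ _
    rw [h1, NormedSpace.exp_add_of_commute (Algebra.commutes _ _)]
    rw [← NormedSpace.algebraMap_exp_comm, ← Real.exp_eq_exp_ℝ, Algebra.algebraMap_eq_smul_one,
      smul_mul_assoc, one_mul]
  rw [hexp, smul_apply, smul_apply, Pi.smul_apply,
    Pi.smul_apply]
  refine smul_le_smul_of_nonneg_left ?_ (Real.exp_pos _).le
  rw [← sub_nonneg, ← Pi.sub_apply, ← map_sub]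
  refine (hasSum_exp_apply K t (g - f) x).nonneg fun n => ?_
  have := hpos n (g - f) (sub_nonneg.2 hfg) x
  exact mul_nonneg (by positivity) this

/-- Exponential growth rate of a positive semigroup with a positive eigenvector on the
invariant set `σ`. -/
theorem tendsto_log_semigroup (H : Module.End ℝ (X → ℝ)) (c : ℝ)
    (hH : ∀ f : X → ℝ, 0 ≤ f → 0 ≤ H f + c • f) (σ : X → Prop)
    (hσ : ∀ f g : X → ℝ, (∀ x, σ x → f x = g x) → ∀ x, σ x → H f x = H g x)
    (v : X → ℝ) (Λ : ℝ) (hv : H v = Λ • v) (hpos : ∀ x, σ x → 0 < v x)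
    (hzero : ∀ x, ¬ σ x → v x = 0) (x : X) (hx : σ x) (L : ℝ) (hL : 0 < L) :
    Tendsto (fun t : ℝ => Real.log (∑' n : ℕ, t ^ n / (n.factorial : ℝ) *
      (H ^ n) (fun _ => 1) x) / (L * t)) atTop (𝓝 (Λ / L)) := by
  classical
  set e : X → ℝ := fun y => if σ y then 1 else 0 with he
  have hvnn : ∀ y, 0 ≤ v y := fun y => by
    by_cases h : σ y
    · exact (hpos y h).le
    · exact (hzero y h).ge
  have hone : ∀ t : ℝ, ∑' n : ℕ, t ^ n / (n.factorial : ℝ) * (H ^ n) (fun _ => 1) x =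
      ∑' n : ℕ, t ^ n / (n.factorial : ℝ) * (H ^ n) e x := fun t =>
    tsum_congr fun n => by
      rw [pow_congr_on H σ hσ n _ e (fun y hy => by simp [he, hy]) x hx]
  -- The indicator `e` of the sector is squeezed between two multiples of `v`, on which the
  -- semigroup acts by `exp(tΛ)`; the constants disappear after division by `t`.
  obtain ⟨a, ha, hav⟩ : ∃ a : ℝ, 0 < a ∧ a • v ≤ e := by
    have hs : 0 < ∑ y, v y :=
      Finset.sum_pos' (fun y _ => hvnn y) ⟨x, Finset.mem_univ _, hpos x hx⟩
    refine ⟨(∑ y, v y)⁻¹, inv_pos.2 hs, fun y => ?_⟩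
    by_cases h : σ y
    · simp only [he, h, if_true, Pi.smul_apply, smul_eq_mul]
      rw [inv_mul_le_iff₀ hs, mul_one]
      exact Finset.single_le_sum (fun y _ => hvnn y) (Finset.mem_univ y)
    · simp [he, h, hzero y h]
  -- Off the sector `v y = 0`, and the convention `0⁻¹ = 0` makes these terms harmless in the sum of
  -- inverses.
  obtain ⟨b, hb, hbv⟩ : ∃ b : ℝ, 0 < b ∧ e ≤ b • v := by
    have hnn : ∀ y, 0 ≤ (v y)⁻¹ := fun y => inv_nonneg.2 (hvnn y)
    refine ⟨∑ y, (v y)⁻¹, Finset.sum_pos' (fun y _ => hnn y)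
      ⟨x, Finset.mem_univ _, inv_pos.2 (hpos x hx)⟩, fun y => ?_⟩
    by_cases h : σ y
    · simp only [he, h, if_true, Pi.smul_apply, smul_eq_mul]
      rw [← inv_mul_cancel₀ (hpos y h).ne']
      exact mul_le_mul_of_nonneg_right
        (Finset.single_le_sum (fun y _ => hnn y) (Finset.mem_univ y)) (hvnn y)
    · simp [he, h, hzero y h]
  have heig : ∀ r : ℝ, H (r • v) = Λ • (r • v) := fun r => by
    rw [map_smul, hv, smul_comm]
  have hvx := hpos x hx
  have hlow : ∀ t : ℝ, 0 ≤ t → Real.exp (t * Λ) * (a * v x) ≤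
      ∑' n : ℕ, t ^ n / (n.factorial : ℝ) * (H ^ n) (fun _ => 1) x := fun t ht => by
    have := tsum_exp_mono H c hH ht hav x
    rwa [tsum_exp_eigenvector H t Λ _ (heig a), ← hone t] at this
  have hup : ∀ t : ℝ, 0 ≤ t → ∑' n : ℕ, t ^ n / (n.factorial : ℝ) * (H ^ n) (fun _ => 1) x ≤
      Real.exp (t * Λ) * (b * v x) := fun t ht => by
    have := tsum_exp_mono H c hH ht hbv x
    rwa [tsum_exp_eigenvector H t Λ _ (heig b), ← hone t] at this
  have hlim : ∀ r : ℝ, Tendsto (fun t : ℝ => Λ / L + r / L * t⁻¹) atTop (𝓝 (Λ / L)) := fun r => by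
    simpa using (tendsto_inv_atTop_zero.const_mul (r / L)).const_add (Λ / L)
  refine tendsto_of_tendsto_of_tendsto_of_le_of_le' (hlim (Real.log (a * v x)))
    (hlim (Real.log (b * v x))) ?_ ?_
  · filter_upwards [eventually_gt_atTop 0] with t ht
    have h := Real.log_le_log (by positivity) (hlow t ht.le)
    rw [Real.log_mul (Real.exp_pos _).ne' (by positivity), Real.log_exp] at h
    rw [le_div_iff₀ (by positivity)]
    refine le_trans (le_of_eq ?_) h
    field_simp
  · filter_upwards [eventually_gt_atTop 0] with t ht
    have h := Real.log_le_log (lt_of_lt_of_le (by positivity) (hlow t ht.le)) (hup t ht.le)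
    rw [Real.log_mul (Real.exp_pos _).ne' (by positivity), Real.log_exp] at h
    rw [div_le_iff₀ (by positivity)]
    refine h.trans (le_of_eq ?_)
    field_simp

end Semigroup

/-! ### Perron–Frobenius by the variational principle -/

section PerronFrobenius

variable {X κ : Type*} [Fintype κ]

/-- The operator `f ↦ ∑ k, r k x f (F k x) - D x f x`. -/
def hopping (F : κ → X → X) (r : κ → X → ℝ) (D : X → ℝ) : Module.End ℝ (X → ℝ) where
  toFun f x := ∑ k, r k x * f (F k x) - D x * f x
  map_add' f g := by
    funext x
    simp only [Pi.add_apply, mul_add, Finset.sum_add_distrib]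
    ring
  map_smul' c f := by
    funext x
    simp only [Pi.smul_apply, smul_eq_mul, RingHom.id_apply, mul_sub, Finset.mul_sum]
    congr 1
    · exact Finset.sum_congr rfl fun k _ => by ring
    · ring

lemma hopping_apply (F : κ → X → X) (r : κ → X → ℝ) (D f : X → ℝ) (x : X) :
    hopping F r D f x = ∑ k, r k x * f (F k x) - D x * f x := rfl

variable [Fintype X]

/-- Substituting `x ↦ F k x` exchanges the two functions in each hopping term, since the rate takes
the same value at both ends of a move. -/
lemma dotProduct_hopping_comm (F : κ → X → X) (hF : ∀ k, Function.Involutive (F k))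
    (r : κ → X → ℝ) (hr : ∀ k x, r k (F k x) = r k x) (D f g : X → ℝ) :
    dotProduct f (hopping F r D g) = dotProduct g (hopping F r D f) := by
  simp only [dotProduct, hopping_apply, mul_sub, Finset.sum_sub_distrib, Finset.mul_sum]
  congr 1
  · rw [Finset.sum_comm, Finset.sum_comm (s := Finset.univ (α := X))]
    refine Finset.sum_congr rfl fun k _ => ?_
    rw [← Equiv.sum_comp (hF k).toPerm]
    refine Finset.sum_congr rfl fun x _ => ?_
    simp only [Function.Involutive.coe_toPerm, hF k x, hr]
    ring
  · exact Finset.sum_congr rfl fun x _ => by ring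

/-- The diamagnetic inequality. -/
lemma dotProduct_hopping_le_abs (F : κ → X → X) (r r' : κ → X → ℝ)
    (hr : ∀ k x, |r' k x| ≤ r k x) (D f : X → ℝ) :
    dotProduct f (hopping F r' D f) ≤ dotProduct |f| (hopping F r D |f|) := by
  simp only [dotProduct, hopping_apply, mul_sub, Pi.abs_apply]
  refine Finset.sum_le_sum fun x _ => sub_le_sub ?_ (le_of_eq ?_)
  · rw [Finset.mul_sum, Finset.mul_sum]
    refine Finset.sum_le_sum fun k _ => (le_abs_self _).trans ?_
    rw [abs_mul, abs_mul]
    have := hr k x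
    gcongr
  · have := abs_mul_abs_self (f x)
    linear_combination D x * this

lemma dotProduct_abs_self (f : X → ℝ) : dotProduct |f| |f| = dotProduct f f :=
  Finset.sum_congr rfl fun x _ => abs_mul_abs_self (f x)

lemma dotProduct_self_nonneg' (f : X → ℝ) : 0 ≤ dotProduct f f :=
  Finset.sum_nonneg fun x _ => mul_self_nonneg (f x)

/-- The quadratic form is maximized over nonnegative unit vectors supported on `σ`, a compact set.
Replacing `f` by `|f|` only increases the form, so the maximum bounds it for signed vectors too, and
the first variation gives the eigenvalue equation. Irreducibility rules out zeros. -/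
theorem exists_perron_eigenvector [DecidableEq X] (F : κ → X → X)
    (hF : ∀ k, Function.Involutive (F k))
    (r : κ → X → ℝ) (hr : ∀ k x, r k (F k x) = r k x) (hrpos : ∀ k x, 0 < r k x) (D : X → ℝ)
    (σ : X → Prop) (hσ : ∀ k x, σ (F k x) ↔ σ x) (x₀ : X) (hx₀ : σ x₀)
    (hirr : ∀ Z : X → Prop, (∀ k x, Z x → Z (F k x)) → ∀ x y, σ x → σ y → Z x → Z y) :
    ∃ (Λ : ℝ) (φ : X → ℝ), (∀ x, σ x → 0 < φ x) ∧ (∀ x, ¬ σ x → φ x = 0) ∧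
      hopping F r D φ = Λ • φ ∧
      ∀ f : X → ℝ, (∀ x, ¬ σ x → f x = 0) →
        dotProduct f (hopping F r D f) ≤ Λ * dotProduct f f := by
  set S := hopping F r D with hS
  set C : Set (X → ℝ) := {g | 0 ≤ g ∧ (∀ x, ¬ σ x → g x = 0) ∧ dotProduct g g = 1} with hC
  have hSc : Continuous S := S.continuous_of_finiteDimensional
  have hquad : Continuous fun g : X → ℝ => dotProduct g (S g) :=
    Continuous.dotProduct continuous_id hSc
  have hCcl : IsClosed C := by
    have h1 : IsClosed {g : X → ℝ | 0 ≤ g} := isClosed_Ici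
    have h2 : IsClosed {g : X → ℝ | ∀ x, ¬ σ x → g x = 0} := by
      simp only [Set.ofPred_forall]
      exact isClosed_iInter fun x => isClosed_iInter fun _ =>
        isClosed_eq (continuous_apply x) continuous_const
    have h3 : IsClosed {g : X → ℝ | dotProduct g g = 1} :=
      isClosed_eq (Continuous.dotProduct continuous_id continuous_id) continuous_const
    exact h1.inter (h2.inter h3)
  have hCcpt : IsCompact C := by
    refine (isCompact_Icc (a := (0 : X → ℝ)) (b := fun _ => 1)).of_isClosed_subset hCcl ?_
    rintro g ⟨h0, -, h1⟩
    refine ⟨h0, fun x => ?_⟩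
    have : g x * g x ≤ 1 := by
      rw [← h1]
      exact Finset.single_le_sum (f := fun x => g x * g x) (fun y _ => mul_self_nonneg _)
        (Finset.mem_univ x)
    nlinarith [h0 x]
  have hCne : C.Nonempty := by
    refine ⟨Pi.single x₀ 1, ?_, ?_, ?_⟩
    · exact Pi.single_nonneg.2 zero_le_one
    · intro x hx
      refine Pi.single_eq_of_ne ?_ _
      rintro rfl; exact hx hx₀
    · simp
  obtain ⟨φ, ⟨hφ0, hφσ, hφ1⟩, hmax⟩ := hCcpt.exists_isMaxOn hCne hquad.continuousOn
  set Λ := dotProduct φ (S φ) with hΛ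
  have hray : ∀ f : X → ℝ, (∀ x, ¬ σ x → f x = 0) →
      dotProduct f (S f) ≤ Λ * dotProduct f f := by
    intro f hf
    refine (dotProduct_hopping_le_abs F r r (fun k x => (abs_of_pos (hrpos k x)).le) D f).trans ?_
    rw [← dotProduct_abs_self f]
    set g := |f| with hg
    have hgσ : ∀ x, ¬ σ x → g x = 0 := fun x hx => by simp [hg, hf x hx]
    rcases (dotProduct_self_nonneg' g).eq_or_lt with h | h
    · have : g = 0 := dotProduct_self_eq_zero.1 h.symm
      simp [this]
    · set s := Real.sqrt (dotProduct g g) with hs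
      have hspos : 0 < s := Real.sqrt_pos.2 h
      have hss : s * s = dotProduct g g := Real.mul_self_sqrt h.le
      have hmem : s⁻¹ • g ∈ C := by
        refine ⟨fun x => mul_nonneg (inv_pos.2 hspos).le (abs_nonneg _), fun x hx => ?_, ?_⟩
        · simp [hgσ x hx]
        · rw [smul_dotProduct, dotProduct_smul, smul_eq_mul, smul_eq_mul, ← hss]
          field_simp
      have hle : dotProduct (s⁻¹ • g) (S (s⁻¹ • g)) ≤ Λ := hmax hmem
      rw [map_smul, smul_dotProduct, dotProduct_smul, smul_eq_mul, smul_eq_mul] at hle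
      rw [← hss]
      have : dotProduct g (S g) = s * s * (s⁻¹ * (s⁻¹ * dotProduct g (S g))) := by
        field_simp
      rw [this, mul_comm Λ]
      exact mul_le_mul_of_nonneg_left hle (by positivity)
  have heig : S φ = Λ • φ := by
    funext x
    by_cases hx : σ x
    · set h : X → ℝ := Pi.single x 1 with hh
      -- The Rayleigh bound at `φ + t • h` has no constant term, so nonnegativity for all `t` forces
      -- the linear coefficient to vanish.
      have hq : ∀ t : ℝ, 0 ≤ (Λ * dotProduct h h - dotProduct h (S h)) * (t * t) +
          2 * (Λ * φ x - S φ x) * t + 0 := by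
        intro t
        have h1 := hray (φ + t • h) (fun y hy => by
          have : y ≠ x := by rintro rfl; exact hy hx
          simp [hh, hφσ y hy, this])
        simp only [map_add, map_smul, add_dotProduct, dotProduct_add, smul_dotProduct,
          dotProduct_smul, smul_eq_mul] at h1
        have e1 : dotProduct φ (S h) = S φ x := by
          rw [hS, dotProduct_hopping_comm F hF r hr, hh, single_one_dotProduct]
        have e2 : dotProduct h (S φ) = S φ x := by rw [hh, single_one_dotProduct]
        have e3 : dotProduct φ h = φ x := by rw [hh, dotProduct_single_one]
        have e4 : dotProduct h φ = φ x := by rw [hh, single_one_dotProduct]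
        rw [e1, e2, e3, e4, hφ1, ← hΛ] at h1
        linarith
      have := discrim_le_zero hq
      simp only [discrim] at this
      have hz : Λ * φ x - S φ x = 0 := by nlinarith
      simp only [Pi.smul_apply, smul_eq_mul]; linarith
    · rw [Pi.smul_apply, hφσ x hx, hS, hopping_apply, hφσ x hx, Finset.sum_eq_zero]
      · simp
      · intro k _
        rw [hφσ _ (by rwa [hσ]), mul_zero]
  -- At a zero of `φ` the eigenvalue equation says that a sum of nonnegative terms is zero, so `φ`
  -- also vanishes at every neighbour.
  have hclosed : ∀ k x, φ x = 0 → φ (F k x) = 0 := by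
    intro k x hx
    have h := congrFun heig x
    rw [Pi.smul_apply, hx, hS, hopping_apply, hx, smul_zero, mul_zero, sub_zero] at h
    have := (Finset.sum_eq_zero_iff_of_nonneg
      (fun k _ => mul_nonneg (hrpos k x).le (hφ0 _))).1 h k (Finset.mem_univ k)
    exact (mul_eq_zero.1 this).resolve_left (hrpos k x).ne'
  refine ⟨Λ, φ, fun x hx => ?_, hφσ, heig, hray⟩
  refine lt_of_le_of_ne (hφ0 x) fun h0 => ?_
  have hz : φ = 0 := by
    funext y
    by_cases hy : σ y
    · exact hirr (fun z => φ z = 0) hclosed x y hx hy h0.symm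
    · exact hφσ y hy
  rw [hz] at hφ1
  simp at hφ1

end PerronFrobenius

/-! ### Extremal values of quadratic forms in Majorana operators -/

section Majorana

variable {X ι : Type*} [Fintype X] [Fintype ι] [DecidableEq ι]

/-- The linear combination `∑ i, c i • A i`. -/
def linComb (A : ι → Module.End ℝ (X → ℝ)) : (ι → ℝ) →ₗ[ℝ] Module.End ℝ (X → ℝ) :=
  Fintype.linearCombination ℝ A

omit [Fintype X] [DecidableEq ι] in
lemma linComb_apply (A : ι → Module.End ℝ (X → ℝ)) (c : ι → ℝ) :
    linComb A c = ∑ i, c i • A i := by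
  simp [linComb, Fintype.linearCombination_apply]

/-- Real Majorana operators: `A i` symmetric with square `1`, `B i` antisymmetric with square `-1`,
all of them anticommuting. -/
structure IsMajorana (A B : ι → Module.End ℝ (X → ℝ)) : Prop where
  AA : ∀ i j, A i * A j + A j * A i = (if i = j then (2 : ℝ) else 0) • 1
  BB : ∀ i j, B i * B j + B j * B i = (if i = j then (-2 : ℝ) else 0) • 1
  AB : ∀ i j, A i * B j + B j * A i = 0
  At : ∀ i f g, dotProduct (A i f) g = dotProduct f (A i g)
  Bt : ∀ i f g, dotProduct (B i f) g = -dotProduct f (B i g)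

omit [Fintype X] in
lemma linComb_anticomm {A : ι → Module.End ℝ (X → ℝ)} {e : ℝ}
    (h : ∀ i j, A i * A j + A j * A i = (if i = j then e else 0) • 1) (c d : ι → ℝ) :
    linComb A c * linComb A d + linComb A d * linComb A c = (e * dotProduct c d) • 1 := by
  have h1 : linComb A c * linComb A d + linComb A d * linComb A c =
      ∑ i, ∑ j, (c i * d j) • (A i * A j + A j * A i) := by
    rw [linComb_apply, linComb_apply, Finset.sum_mul_sum, Finset.sum_mul_sum,
      Finset.sum_comm (s := Finset.univ) (t := Finset.univ) (f := fun i j => d i • A i * c j • A j),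
      ← Finset.sum_add_distrib]
    refine Finset.sum_congr rfl fun i _ => ?_
    rw [← Finset.sum_add_distrib]
    refine Finset.sum_congr rfl fun j _ => ?_
    rw [smul_mul_smul_comm, smul_mul_smul_comm, smul_add, mul_comm (d j)]
  rw [h1]
  simp only [h, smul_smul, ← Finset.sum_smul]
  congr 1
  simp [dotProduct, Finset.mul_sum, mul_comm]

omit [Fintype X] [DecidableEq ι] in
lemma linComb_anticomm_of_zero {A : ι → Module.End ℝ (X → ℝ)} {Q : Module.End ℝ (X → ℝ)}
    (h : ∀ i, A i * Q + Q * A i = 0) (c : ι → ℝ) : linComb A c * Q + Q * linComb A c = 0 := by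
  rw [linComb_apply, Finset.sum_mul, Finset.mul_sum, ← Finset.sum_add_distrib]
  refine Finset.sum_eq_zero fun i _ => ?_
  rw [smul_mul_assoc, mul_smul_comm, ← smul_add, h, smul_zero]

omit [DecidableEq ι] in
lemma linComb_adjoint {A : ι → Module.End ℝ (X → ℝ)} {e : ℝ}
    (h : ∀ i f g, dotProduct (A i f) g = e * dotProduct f (A i g)) (c : ι → ℝ) (f g : X → ℝ) :
    dotProduct (linComb A c f) g = e * dotProduct f (linComb A c g) := by
  rw [linComb_apply]
  simp only [LinearMap.sum_apply, LinearMap.smul_apply, sum_dotProduct, dotProduct_sum,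
    smul_dotProduct, dotProduct_smul, h, Finset.mul_sum, smul_eq_mul]
  exact Finset.sum_congr rfl fun i _ => by ring

/-- The quadratic operator `∑ j l, M j l • (B j * A l)`. -/
def majoranaForm (A B : ι → Module.End ℝ (X → ℝ)) (M : Matrix ι ι ℝ) : Module.End ℝ (X → ℝ) :=
  ∑ j, B j * linComb A (M j)

variable {A B : ι → Module.End ℝ (X → ℝ)} (h : IsMajorana A B)

include h

/-- Only the symmetric part of `A(c) A(d)` contributes to a quadratic form, and anticommutation
makes it the scalar `c · d`. -/
lemma IsMajorana.dotProduct_linComb (c d : ι → ℝ) (f : X → ℝ) :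
    dotProduct (linComb A c f) (linComb A d f) = dotProduct c d * dotProduct f f := by
  have hAt : ∀ c f g, dotProduct (linComb A c f) g = dotProduct f (linComb A c g) := fun c f g => by
    simpa using linComb_adjoint (e := 1) (fun i f g => by rw [h.At, one_mul]) c f g
  have h1 := congrArg (fun T : Module.End ℝ (X → ℝ) => dotProduct f (T f))
    (linComb_anticomm h.AA c d)
  simp only [LinearMap.add_apply, Module.End.mul_apply, dotProduct_add, LinearMap.smul_apply,
    Module.End.one_apply, dotProduct_smul, smul_eq_mul] at h1
  rw [← hAt c f (linComb A d f), ← hAt d f (linComb A c f), dotProduct_comm (linComb A d f)] at h1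
  linarith

lemma IsMajorana.dotProduct_linComb_B (c : ι → ℝ) (f : X → ℝ) :
    dotProduct (linComb B c f) (linComb B c f) = dotProduct c c * dotProduct f f := by
  have h1 := congrArg (fun T : Module.End ℝ (X → ℝ) => dotProduct f (T f))
    (linComb_anticomm h.BB c c)
  simp only [LinearMap.add_apply, Module.End.mul_apply, dotProduct_add, LinearMap.smul_apply,
    Module.End.one_apply, dotProduct_smul, smul_eq_mul] at h1
  rw [linComb_adjoint (e := -1) (fun i f g => by rw [h.Bt]; ring)]
  linarith

/-- Upper bound by (an upper bound of) the trace norm. -/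
lemma IsMajorana.form_le (W R : Matrix ι ι ℝ) (f : X → ℝ) :
    dotProduct f (majoranaForm A B (W * R) f) ≤
      ((W * W.transpose).trace + (R * R.transpose).trace) / 2 * dotProduct f f := by
  -- The factorization splits the form into products of one `B` mode, a column of `W`, and one `A`
  -- mode, a row of `R`.
  have hM : majoranaForm A B (W * R) = ∑ a, linComb B (W.transpose a) * linComb A (R a) := by
    have h1 : ∀ j, linComb A ((W * R) j) = ∑ a, W j a • linComb A (R a) := fun j => by
      rw [← Finset.sum_congr rfl (fun a _ => map_smul (linComb A) (W j a) (R a)), ← map_sum]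
      congr 1
      funext l
      simp [Matrix.mul_apply]
    simp only [majoranaForm, h1, Finset.mul_sum]
    rw [Finset.sum_comm]
    refine Finset.sum_congr rfl fun a _ => ?_
    rw [linComb_apply B, Finset.sum_mul]
    refine Finset.sum_congr rfl fun j _ => ?_
    rw [mul_smul_comm, smul_mul_assoc, Matrix.transpose_apply]
  -- Each product equals `-⟨p, q⟩`, with the norms of `p` and `q` known exactly; `‖p + q‖² ≥ 0`
  -- bounds it.
  have key : ∀ a, dotProduct f ((linComb B (W.transpose a) * linComb A (R a)) f) ≤
      (dotProduct (W.transpose a) (W.transpose a) + dotProduct (R a) (R a)) / 2 *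
        dotProduct f f := by
    intro a
    set p := linComb B (W.transpose a) f with hp
    set q := linComb A (R a) f with hq
    have e1 : dotProduct f ((linComb B (W.transpose a) * linComb A (R a)) f) = -dotProduct p q := by
      rw [hp, linComb_adjoint (e := -1) (fun i f g => by rw [h.Bt]; ring)]
      simp [hq]
    have e2 := h.dotProduct_linComb_B (W.transpose a) f
    have e3 := h.dotProduct_linComb (R a) (R a) f
    have e4 := dotProduct_self_nonneg' (p + q)
    rw [add_dotProduct, dotProduct_add, dotProduct_add, dotProduct_comm q p] at e4
    rw [e1]
    nlinarith
  rw [hM, LinearMap.sum_apply, dotProduct_sum]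
  refine (Finset.sum_le_sum fun a _ => key a).trans (le_of_eq ?_)
  rw [← Finset.sum_mul, ← Finset.sum_div, Finset.sum_add_distrib]
  congr 3
  · simp only [Matrix.trace, Matrix.diag, Matrix.mul_apply, dotProduct, Matrix.transpose_apply]
    exact Finset.sum_comm

omit h [Fintype X] [Fintype ι] [DecidableEq ι] in
/-- A joint kernel vector of anticommuting, nilpotent, parity-odd operators. -/
lemma exists_vacuum (s : Finset ι) (b : ι → Module.End ℝ (X → ℝ)) (Pt : Module.End ℝ (X → ℝ))
    (hb : ∀ i j, b i * b j + b j * b i = 0) (hP : ∀ i, Pt * b i = -(b i * Pt))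
    (v : X → ℝ) (hv : v ≠ 0) (hPv : Pt v = v ∨ Pt v = -v) :
    ∃ Ω : X → ℝ, Ω ≠ 0 ∧ (Pt Ω = Ω ∨ Pt Ω = -Ω) ∧ ∀ i ∈ s, b i Ω = 0 := by
  classical
  induction s using Finset.induction_on with
  | empty => exact ⟨v, hv, hPv, by simp⟩
  | insert i s hi ih =>
    obtain ⟨Ω, hΩ, hpar, hk⟩ := ih
    by_cases hz : b i Ω = 0
    · refine ⟨Ω, hΩ, hpar, fun j hj => ?_⟩
      rcases Finset.mem_insert.1 hj with rfl | hj
      · exact hz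
      · exact hk j hj
    -- If `b i` does not kill `Ω`, the vector `b i Ω` replaces it: `b i` squares to zero,
    -- anticommutation preserves the kernels already obtained, and the parity flips.
    · refine ⟨b i Ω, hz, ?_, fun j hj => ?_⟩
      · have h1 := LinearMap.congr_fun (hP i) Ω
        simp only [Module.End.mul_apply, LinearMap.neg_apply] at h1
        rcases hpar with hp | hp
        · right; rw [h1, hp]
        · left; rw [h1, hp, map_neg, neg_neg]
      · have h1 := LinearMap.congr_fun (hb j i) Ω
        simp only [Module.End.mul_apply, LinearMap.add_apply, LinearMap.zero_apply] at h1
        rcases Finset.mem_insert.1 hj with rfl | hj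
        · have : (2 : ℝ) • b j (b j Ω) = 0 := by rw [two_smul]; exact h1
          exact (smul_eq_zero.1 this).resolve_left two_ne_zero
        · rw [hk j hj, map_zero, add_zero] at h1
          exact h1

/-- The trace norm is attained by a vector of definite parity. -/
lemma IsMajorana.exists_form_eq (U M : Matrix ι ι ℝ) (hU : U * U.transpose = 1)
    (Pt : Module.End ℝ (X → ℝ)) (hPA : ∀ i, Pt * A i = -(A i * Pt))
    (hPB : ∀ i, Pt * B i = -(B i * Pt)) (v : X → ℝ) (hv : v ≠ 0) (hPv : Pt v = v ∨ Pt v = -v) :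
    ∃ Ω : X → ℝ, Ω ≠ 0 ∧ (Pt Ω = Ω ∨ Pt Ω = -Ω) ∧ (∀ i, B i Ω = -linComb A (U i) Ω) ∧
      dotProduct Ω (majoranaForm A B M Ω) = (M * U.transpose).trace * dotProduct Ω Ω := by
  have hUU : ∀ i j, dotProduct (U i) (U j) = if i = j then 1 else 0 := fun i j => by
    have := congrFun (congrFun hU i) j
    rwa [Matrix.mul_apply', Matrix.one_apply] at this
  -- The annihilators `A(U_i) + B_i` anticommute because the rows of `U` are orthonormal: the `AA`
  -- part gives `2δ` and the `BB` part `-2δ`.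
  obtain ⟨Ω, hΩ, hpar, hk⟩ := exists_vacuum Finset.univ (fun i => linComb A (U i) + B i) Pt
    (fun i j => by
      have h1 := linComb_anticomm h.AA (U i) (U j)
      have h2 := h.BB i j
      have h3 := linComb_anticomm_of_zero (fun l => h.AB l j) (U i)
      have h4 := linComb_anticomm_of_zero (fun l => h.AB l i) (U j)
      have h5 : (linComb A (U i) + B i) * (linComb A (U j) + B j) +
          (linComb A (U j) + B j) * (linComb A (U i) + B i) =
          (linComb A (U i) * linComb A (U j) + linComb A (U j) * linComb A (U i)) +
          (B i * B j + B j * B i) + (linComb A (U i) * B j + B j * linComb A (U i)) +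
          (linComb A (U j) * B i + B i * linComb A (U j)) := by noncomm_ring
      rw [h5, h1, h2, h3, h4, hUU, add_zero, add_zero, ← add_smul]
      split_ifs <;> simp)
    (fun i => by
      have h1 := linComb_anticomm_of_zero (A := A) (Q := Pt)
        (fun l => by rw [hPA]; simp) (U i)
      rw [mul_add, add_mul, neg_add, hPB, eq_neg_of_add_eq_zero_right h1])
    v hv hPv
  have hB : ∀ i, B i Ω = -linComb A (U i) Ω := fun i =>
    eq_neg_of_add_eq_zero_right (hk i (Finset.mem_univ i))
  refine ⟨Ω, hΩ, hpar, hB, ?_⟩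
  rw [majoranaForm, LinearMap.sum_apply, dotProduct_sum]
  have : ∀ j, dotProduct Ω ((B j * linComb A (M j)) Ω) =
      dotProduct (M j) (U j) * dotProduct Ω Ω := fun j => by
    rw [Module.End.mul_apply, ← neg_neg (dotProduct Ω _), ← h.Bt, hB, neg_dotProduct,
      h.dotProduct_linComb, neg_neg, dotProduct_comm (U j)]
  rw [Finset.sum_congr rfl fun j _ => this j, ← Finset.sum_mul]
  rfl

/-- A zero mode of `M` allows to change the parity. -/
lemma IsMajorana.exists_form_eq_swap (U M : Matrix ι ι ℝ) (hU : U * U.transpose = 1)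
    (Pt : Module.End ℝ (X → ℝ)) (hPA : ∀ i, Pt * A i = -(A i * Pt))
    (w : ι → ℝ) (hw : dotProduct w w = 1) (hwM : Matrix.vecMul w M = 0)
    (Ω : X → ℝ) (hΩ : Ω ≠ 0) (hB : ∀ i, B i Ω = -linComb A (U i) Ω) :
    ∃ ψ : X → ℝ, ψ ≠ 0 ∧ (Pt Ω = Ω → Pt ψ = -ψ) ∧
      dotProduct ψ (majoranaForm A B M ψ) = (M * U.transpose).trace * dotProduct ψ ψ := by
  -- The zero mode `w` is transported by `U` to the `A` modes; `A(c)` is an odd involution with `c ·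
  -- U_j = w_j`.
  set c := Matrix.vecMul w U with hc
  set a := linComb A c with ha
  have hcU : ∀ j, dotProduct c (U j) = w j := fun j => by
    have : Matrix.vecMul (Matrix.vecMul w U) U.transpose = w := by
      rw [Matrix.vecMul_vecMul, hU, Matrix.vecMul_one]
    exact congrFun this j
  have hcc : dotProduct c c = 1 := by
    rw [hc, ← Matrix.dotProduct_mulVec, ← Matrix.vecMul_transpose, Matrix.vecMul_vecMul, hU,
      Matrix.vecMul_one, hw]
  have haa : ∀ f, a (a f) = f := fun f => by
    have h1 := LinearMap.congr_fun (linComb_anticomm h.AA c c) f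
    rw [hcc] at h1
    simp only [Module.End.mul_apply, LinearMap.smul_apply,
      Module.End.one_apply, mul_one, ← two_smul ℝ] at h1
    exact smul_right_injective _ (two_ne_zero (α := ℝ)) h1
  have hBψ : ∀ j, B j (a Ω) = -linComb A (U j) (a Ω) + (2 * w j) • Ω := fun j => by
    have h1 := LinearMap.congr_fun (linComb_anticomm h.AA c (U j)) Ω
    have h2 := LinearMap.congr_fun (linComb_anticomm_of_zero (fun l => h.AB l j) c) Ω
    simp only [LinearMap.add_apply, Module.End.mul_apply, LinearMap.smul_apply,
      Module.End.one_apply, LinearMap.zero_apply, hB, map_neg, hcU] at h1 h2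
    rw [← h1, ← ha]
    rw [← ha] at h2
    rw [eq_neg_of_add_eq_zero_right h2, neg_neg]
    abel
  refine ⟨a Ω, fun h0 => hΩ (by rw [← haa Ω, h0, map_zero]), fun hp => ?_, ?_⟩
  · have h1 := linComb_anticomm_of_zero (A := A) (Q := Pt) (fun l => by rw [hPA]; simp) c
    have h2 := LinearMap.congr_fun h1 Ω
    simp only [LinearMap.add_apply, Module.End.mul_apply, LinearMap.zero_apply, hp] at h2
    exact eq_neg_of_add_eq_zero_right h2
  · rw [majoranaForm, LinearMap.sum_apply, dotProduct_sum]
    have : ∀ j, dotProduct (a Ω) ((B j * linComb A (M j)) (a Ω)) =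
        dotProduct (M j) (U j) * dotProduct (a Ω) (a Ω) -
          2 * dotProduct Ω (w j • linComb A (M j) (a Ω)) := fun j => by
      rw [Module.End.mul_apply, ← neg_neg (dotProduct (a Ω) (B j _)), ← h.Bt, hBψ, add_dotProduct,
        neg_dotProduct, h.dotProduct_linComb, dotProduct_comm (U j), smul_dotProduct,
        dotProduct_smul, smul_eq_mul, smul_eq_mul]
      ring
    rw [Finset.sum_congr rfl fun j _ => this j, Finset.sum_sub_distrib, ← Finset.sum_mul,
      ← Finset.mul_sum, ← dotProduct_sum]
    -- The only change caused by `A(c)` in the value of the form is this combination, which is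
    -- `A(wM)` applied to a vector and vanishes with `wM`.
    have hz : ∑ j, w j • linComb A (M j) (a Ω) = 0 := by
      have h1 : ∑ j, w j • linComb A (M j) = linComb A (Matrix.vecMul w M) := by
        rw [Finset.sum_congr rfl fun j _ => (map_smul (linComb A) (w j) (M j)).symm, ← map_sum]
        congr 1
        funext l
        simp [Matrix.vecMul, dotProduct]
      rw [hwM, map_zero] at h1
      have := LinearMap.congr_fun h1 (a Ω)
      simpa using this
    rw [hz, dotProduct_zero, mul_zero, sub_zero]
    rfl

end Majorana

/-! ### Jordan–Wigner transformation of the chain -/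

section JordanWigner

variable {L : ℕ}

/-- The configuration flipped at the site `j`. -/
def flipAt (j : Fin L) (η : Config L) : Config L := Function.update η j (!(η j))

lemma flipAt_apply (j : Fin L) (η : Config L) (i : Fin L) :
    flipAt j η i = if i = j then !(η j) else η i := by
  simp [flipAt, Function.update_apply]

lemma flipAt_involutive (j : Fin L) : Function.Involutive (flipAt j) := fun η => by
  funext i
  by_cases h : i = j
  · subst h; simp [flipAt_apply]
  · simp only [flipAt_apply, h, if_false]

lemma flipAt_comm (i j : Fin L) (η : Config L) :
    flipAt i (flipAt j η) = flipAt j (flipAt i η) := by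
  funext l
  simp only [flipAt_apply]
  by_cases hi : l = i
  · by_cases hj : l = j
    · rw [← hi, ← hj]
    · have : i ≠ j := fun h => hj (hi.trans h)
      rw [if_pos hi, if_neg this, if_neg hj, if_pos hi]
  · by_cases hj : l = j
    · have : j ≠ i := fun h => hi (hj.trans h)
      rw [if_neg hi, if_pos hj, if_pos hj, if_neg this]
    · rw [if_neg hi, if_neg hj, if_neg hj, if_neg hi]

lemma prod_flipAt (g : Bool → ℝ) (hg : ∀ b, g b ≠ 0) (s : Finset (Fin L)) (k : Fin L)
    (η : Config L) :
    ∏ i ∈ s, g (flipAt k η i) = (if k ∈ s then g (!(η k)) / g (η k) else 1) * ∏ i ∈ s, g (η i) := by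
  have h1 : ∀ i, g (flipAt k η i) = (if k = i then g (!(η k)) / g (η k) else 1) * g (η i) := by
    intro i
    rw [flipAt_apply]
    by_cases h : k = i
    · subst h; simp [div_mul_cancel₀ _ (hg (η k))]
    · simp [h, Ne.symm h]
  rw [Finset.prod_congr rfl fun i _ => h1 i, Finset.prod_mul_distrib, Finset.prod_ite_eq]

/-- The eigenvalue `±1` of `σᶻ`: `1` for an empty site and `-1` for an occupied site. -/
def spin (b : Bool) : ℝ := if b then -1 else 1

lemma spin_not (b : Bool) : spin (!b) = -spin b := by cases b <;> simp [spin]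

lemma spin_ne_zero (b : Bool) : spin b ≠ 0 := by cases b <;> simp [spin]

lemma spin_mul_self (b : Bool) : spin b * spin b = 1 := by cases b <;> simp [spin]

/-- The product of the spins over a set of sites. -/
def spinProd (s : Finset (Fin L)) (η : Config L) : ℝ := ∏ i ∈ s, spin (η i)

lemma spinProd_mul_self (s : Finset (Fin L)) (η : Config L) :
    spinProd s η * spinProd s η = 1 := by
  rw [spinProd, ← Finset.prod_mul_distrib]
  exact Finset.prod_eq_one fun i _ => spin_mul_self _

lemma spinProd_flipAt (s : Finset (Fin L)) (k : Fin L) (η : Config L) :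
    spinProd s (flipAt k η) = (if k ∈ s then -1 else 1) * spinProd s η := by
  rw [spinProd, prod_flipAt _ spin_ne_zero, spin_not, neg_div, div_self (spin_ne_zero _)]
  rfl

lemma spin_flipAt (k j : Fin L) (η : Config L) :
    spin (flipAt k η j) = (if k = j then -1 else 1) * spin (η j) := by
  have := spinProd_flipAt {j} k η
  simpa [spinProd] using this

/-- The Majorana operator `(∏_{i<j} σᶻ_i) σˣ_j`. -/
def jwA (j : Fin L) : Module.End ℝ (Config L → ℝ) where
  toFun f η := spinProd (Finset.Iio j) η * f (flipAt j η)
  map_add' f g := by funext η; simp [mul_add]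
  map_smul' c f := by funext η; simp; ring

/-- The Majorana operator `(∏_{i<j} σᶻ_i) σˣ_j σᶻ_j`. -/
def jwB (j : Fin L) : Module.End ℝ (Config L → ℝ) where
  toFun f η := -(spinProd (Finset.Iio j) η * spin (η j) * f (flipAt j η))
  map_add' f g := by funext η; simp; ring
  map_smul' c f := by funext η; simp; ring

/-- The parity operator. -/
def parityOp (L : ℕ) : Module.End ℝ (Config L → ℝ) where
  toFun f η := spinProd Finset.univ η * f η
  map_add' f g := by funext η; simp; ring
  map_smul' c f := by funext η; simp; ring

lemma jwA_apply (j : Fin L) (f : Config L → ℝ) (η : Config L) :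
    jwA j f η = spinProd (Finset.Iio j) η * f (flipAt j η) := rfl

lemma jwB_apply (j : Fin L) (f : Config L → ℝ) (η : Config L) :
    jwB j f η = -(spinProd (Finset.Iio j) η * spin (η j) * f (flipAt j η)) := rfl

lemma parityOp_apply (f : Config L → ℝ) (η : Config L) :
    parityOp L f η = spinProd Finset.univ η * f η := rfl

lemma sum_flipAt (j : Fin L) (F : Config L → ℝ) : ∑ η, F (flipAt j η) = ∑ η, F η :=
  Equiv.sum_comp (flipAt_involutive j).toPerm F

/-- For distinct sites the string of the larger one contains the smaller one, and flipping there
produces the sign of anticommutation. -/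
lemma isMajorana_jw : IsMajorana (jwA (L := L)) jwB where
  AA i j := by
    refine LinearMap.ext fun f => funext fun η => ?_
    simp only [LinearMap.add_apply, Module.End.mul_apply, Pi.add_apply, jwA_apply,
      LinearMap.smul_apply, Module.End.one_apply, Pi.smul_apply, smul_eq_mul, spinProd_flipAt,
      Finset.mem_Iio]
    rcases lt_trichotomy i j with h | rfl | h
    · simp only [h, h.ne, h.not_gt, if_true, if_false, flipAt_comm j i]; ring
    · simp only [lt_irrefl, if_false, if_true, flipAt_involutive i η]
      linear_combination 2 * f η * spinProd_mul_self (Finset.Iio i) η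
    · simp only [h, h.ne', h.not_gt, if_true, if_false, flipAt_comm j i]; ring
  BB i j := by
    refine LinearMap.ext fun f => funext fun η => ?_
    simp only [LinearMap.add_apply, Module.End.mul_apply, Pi.add_apply, jwB_apply,
      LinearMap.smul_apply, Module.End.one_apply, Pi.smul_apply, smul_eq_mul, spinProd_flipAt,
      Finset.mem_Iio, spin_flipAt]
    rcases lt_trichotomy i j with h | rfl | h
    · simp only [h, h.ne, h.ne', h.not_gt, if_true, if_false, flipAt_comm j i]; ring
    · simp only [lt_irrefl, if_false, if_true, flipAt_involutive i η]
      linear_combination -2 * f η * (spin (η i) * spin (η i)) * spinProd_mul_self (Finset.Iio i) η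
        - 2 * f η * spin_mul_self (η i)
    · simp only [h, h.ne, h.ne', h.not_gt, if_true, if_false, flipAt_comm j i]; ring
  AB i j := by
    refine LinearMap.ext fun f => funext fun η => ?_
    simp only [LinearMap.add_apply, Module.End.mul_apply, Pi.add_apply, jwA_apply, jwB_apply,
      LinearMap.zero_apply, Pi.zero_apply, spinProd_flipAt, Finset.mem_Iio, spin_flipAt]
    rcases lt_trichotomy i j with h | rfl | h
    · simp only [h, h.ne, h.not_gt, if_true, if_false, flipAt_comm j i]; ring
    · simp only [lt_irrefl, if_false, if_true]; ring
    · simp only [h, h.ne', h.not_gt, if_true, if_false, flipAt_comm j i]; ring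
  At j f g := by
    simp only [dotProduct, jwA_apply]
    rw [← sum_flipAt j]
    refine Finset.sum_congr rfl fun η _ => ?_
    rw [flipAt_involutive j η, spinProd_flipAt]
    simp only [Finset.mem_Iio, lt_irrefl, if_false]; ring
  Bt j f g := by
    simp only [dotProduct, jwB_apply]
    rw [← sum_flipAt j, ← Finset.sum_neg_distrib]
    refine Finset.sum_congr rfl fun η _ => ?_
    rw [flipAt_involutive j η, spinProd_flipAt, spin_flipAt]
    simp only [Finset.mem_Iio, lt_irrefl, if_false, if_true]; ring

lemma parityOp_mul_jwA (j : Fin L) : parityOp L * jwA j = -(jwA j * parityOp L) := by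
  refine LinearMap.ext fun f => funext fun η => ?_
  simp only [Module.End.mul_apply, LinearMap.neg_apply, Pi.neg_apply, parityOp_apply, jwA_apply,
    spinProd_flipAt, Finset.mem_univ, if_true]
  ring

lemma parityOp_mul_jwB (j : Fin L) : parityOp L * jwB j = -(jwB j * parityOp L) := by
  refine LinearMap.ext fun f => funext fun η => ?_
  simp only [Module.End.mul_apply, LinearMap.neg_apply, Pi.neg_apply, parityOp_apply, jwB_apply,
    spinProd_flipAt, Finset.mem_univ, if_true]
  ring

/-! ### Bonds of the ring -/

lemma finRotate_val (k : Fin L) :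
    (finRotate L k : ℕ) = if (k : ℕ) + 1 = L then 0 else (k : ℕ) + 1 := by
  obtain _ | n := L
  · exact k.elim0
  · split_ifs with h
    · have : k = Fin.last n := Fin.ext (by simpa using h)
      simp [this]
    · exact coe_finRotate_of_ne_last (fun h' => h (by simp [h']))

lemma finRotate_ne (hL : 2 ≤ L) (k : Fin L) : finRotate L k ≠ k := by
  intro h
  have := finRotate_val k
  rw [h] at this
  split_ifs at this <;> omega

lemma flip_eq_flipAt (hL : 2 ≤ L) (η : Config L) (k : Fin L) :
    flip η k = flipAt (finRotate L k) (flipAt k η) := by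
  have h := finRotate_ne hL k
  funext j
  simp only [flip, flipAt_apply]
  generalize finRotate L k = l at h ⊢
  by_cases h1 : j = k
  · subst h1; simp [h.symm]
  · by_cases h2 : j = l
    · simp [h2, h]
    · simp [h1, h2]

lemma flip_involutive (hL : 2 ≤ L) (k : Fin L) :
    Function.Involutive fun η : Config L => flip η k := fun η => by
  simp only [flip_eq_flipAt hL]
  rw [flipAt_comm k, flipAt_involutive, flipAt_involutive]

lemma spinProd_univ_flip (hL : 2 ≤ L) (η : Config L) (k : Fin L) :
    spinProd Finset.univ (flip η k) = spinProd Finset.univ η := by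
  rw [flip_eq_flipAt hL, spinProd_flipAt, spinProd_flipAt]; simp

/-- The boundary sign `τ` on the bond `(L - 1, 0)`. -/
def bondSign (L : ℕ) (τ : ℝ) (k : Fin L) : ℝ := if (k : ℕ) + 1 = L then τ else 1

/-- The symmetrized rate of the bond `(k, k + 1)`: `1 / 2` if the occupation numbers differ,
`γ / 2` if they agree. -/
def bondRate (γ : ℝ) (k : Fin L) (η : Config L) : ℝ :=
  (1 + γ) / 4 - (1 - γ) / 4 * (spin (η k) * spin (η (finRotate L k)))

/-- The total exit rate for the jump rate `1 / 2`. -/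
def exitRate (μ : ℝ) (η : Config L) : ℝ :=
  ∑ k, (μ + 1 / 2 * ((occ η k : ℝ) + occ η (finRotate L k)))

lemma bondRate_flip (hL : 2 ≤ L) (γ : ℝ) (k : Fin L) (η : Config L) :
    bondRate γ k (flip η k) = bondRate γ k η := by
  have h := finRotate_ne hL k
  unfold bondRate
  rw [flip_eq_flipAt hL, spin_flipAt, spin_flipAt, spin_flipAt, spin_flipAt]
  generalize finRotate L k = l at h ⊢
  simp [h, h.symm]

lemma bondRate_pos {γ : ℝ} (hγ : 0 < γ) (k : Fin L) (η : Config L) :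
    0 < bondRate γ k η := by
  unfold bondRate
  cases η k <;> cases η (finRotate L k) <;> simp [spin] <;> linarith

/-- The twisted shift matrix. -/
def shiftMatrix (L : ℕ) (θ : ℝ) : Matrix (Fin L) (Fin L) ℝ :=
  Matrix.of fun j l => if l = finRotate L j then bondSign L θ j else 0

/-- The coefficient matrix of the XY chain. -/
def xyMatrix (L : ℕ) (γ θ : ℝ) : Matrix (Fin L) (Fin L) ℝ :=
  ((1 + γ) / 4) • shiftMatrix L θ + ((1 - γ) / 4) • (shiftMatrix L θ).transpose
    - (1 / 2 : ℝ) • (1 : Matrix (Fin L) (Fin L) ℝ)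

lemma spinProd_Iio_finRotate (k : Fin L) (hk : (k : ℕ) + 1 ≠ L) (η : Config L) :
    spinProd (Finset.Iio (finRotate L k)) η = spinProd (Finset.Iio k) η * spin (η k) := by
  have h := finRotate_val k
  rw [if_neg hk] at h
  have : Finset.Iio (finRotate L k) = insert k (Finset.Iio k) := by
    ext i
    simp only [Finset.mem_Iio, Finset.mem_insert, Fin.lt_def, h, Fin.ext_iff]
    omega
  rw [this, spinProd, Finset.prod_insert (by simp), mul_comm]; rfl

lemma spinProd_univ_last (k : Fin L) (hk : (k : ℕ) + 1 = L) (η : Config L) :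
    spinProd Finset.univ η = spinProd (Finset.Iio k) η * spin (η k) := by
  have : Finset.univ = insert k (Finset.Iio k) := by
    ext i
    simp only [Finset.mem_univ, Finset.mem_Iio, Finset.mem_insert, Fin.lt_def, Fin.ext_iff,
      true_iff]
    omega
  rw [this, spinProd, Finset.prod_insert (by simp), mul_comm]; rfl

lemma spinProd_Iio_rotate_last (k : Fin L) (hk : (k : ℕ) + 1 = L) (η : Config L) :
    spinProd (Finset.Iio (finRotate L k)) η = 1 := by
  have h := finRotate_val k
  rw [if_pos hk] at h
  have : Finset.Iio (finRotate L k) = ∅ := by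
    ext i
    rw [Finset.mem_Iio, Fin.lt_def, h]
    simp
  rw [this, spinProd, Finset.prod_empty]

variable {σ θ : ℝ}

/-- In the bulk the two strings cancel and leave a bare flip. On the closing bond they cover the
whole ring and give the total parity, so the fermionic boundary sign `θ` becomes `-σθ` for spins. -/
lemma jwB_jwA_bond (hL : 2 ≤ L) (f : Config L → ℝ) (hf : parityOp L f = σ • f)
    (k : Fin L) (η : Config L) :
    bondSign L θ k * jwB k (jwA (finRotate L k) f) η =
      bondSign L (-(σ * θ)) k * f (flip η k) := by
  have hne := finRotate_ne hL k
  rw [jwB_apply, jwA_apply, ← flip_eq_flipAt hL, bondSign, bondSign]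
  split_ifs with hk
  · rw [spinProd_Iio_rotate_last k hk, ← spinProd_univ_last k hk]
    have h := congrFun hf (flip η k)
    rw [parityOp_apply, spinProd_univ_flip hL, Pi.smul_apply, smul_eq_mul] at h
    linear_combination -θ * h
  · rw [spinProd_Iio_finRotate k hk, spinProd_flipAt, spin_flipAt]
    simp only [Finset.mem_Iio, lt_irrefl, if_false, if_true]
    linear_combination f (flip η k) * (spin (η k) * spin (η k)) *
      spinProd_mul_self (Finset.Iio k) η + f (flip η k) * spin_mul_self (η k)

lemma jwB_jwA_bond' (hL : 2 ≤ L) (f : Config L → ℝ) (hf : parityOp L f = σ • f)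
    (k : Fin L) (η : Config L) :
    bondSign L θ k * jwB (finRotate L k) (jwA k f) η =
      -(bondSign L (-(σ * θ)) k * (spin (η k) * spin (η (finRotate L k))) * f (flip η k)) := by
  have hne := finRotate_ne hL k
  rw [jwB_apply, jwA_apply, flipAt_comm, ← flip_eq_flipAt hL, bondSign, bondSign]
  have hv := finRotate_val k
  split_ifs with hk
  · rw [if_pos hk] at hv
    rw [spinProd_Iio_rotate_last k hk, spinProd_flipAt]
    have hlt : finRotate L k ∈ Finset.Iio k := by
      rw [Finset.mem_Iio, Fin.lt_def, hv]; omega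
    have h := congrFun hf (flip η k)
    rw [parityOp_apply, spinProd_univ_flip hL, Pi.smul_apply, smul_eq_mul,
      spinProd_univ_last k hk] at h
    rw [if_pos hlt]
    linear_combination θ * (spin (η k) * spin (η (finRotate L k))) * h -
      θ * spin (η (finRotate L k)) * spinProd (Finset.Iio k) η * f (flip η k) *
        spin_mul_self (η k)
  · rw [if_neg hk] at hv
    rw [spinProd_Iio_finRotate k hk, spinProd_flipAt]
    have hlt : finRotate L k ∉ Finset.Iio k := by
      rw [Finset.mem_Iio, Fin.lt_def, hv]; omega
    rw [if_neg hlt]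
    linear_combination -(f (flip η k)) * (spin (η k) * spin (η (finRotate L k))) *
      spinProd_mul_self (Finset.Iio k) η

lemma jwB_jwA_self (f : Config L → ℝ) (k : Fin L) (η : Config L) :
    jwB k (jwA k f) η = -(spin (η k) * f η) := by
  rw [jwB_apply, jwA_apply, flipAt_involutive, spinProd_flipAt]
  simp only [Finset.mem_Iio, lt_irrefl, if_false]
  linear_combination -(f η) * spin (η k) * spinProd_mul_self (Finset.Iio k) η

lemma majoranaForm_apply {X ι : Type*} [Fintype ι] (A B : ι → Module.End ℝ (X → ℝ))
    (M : Matrix ι ι ℝ) (f : X → ℝ) (x : X) :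
    majoranaForm A B M f x = ∑ j, ∑ l, M j l * B j (A l f) x := by
  simp [majoranaForm, linComb_apply, LinearMap.sum_apply, Finset.sum_apply]

lemma sum_occ_rotate (η : Config L) : ∑ k, (occ η (finRotate L k) : ℝ) = ∑ k, (occ η k : ℝ) :=
  Equiv.sum_comp (finRotate L) fun k => (occ η k : ℝ)

lemma spin_eq (η : Config L) (k : Fin L) : spin (η k) = 1 - 2 * (occ η k : ℝ) := by
  unfold spin occ; cases η k <;> norm_num

/-- The XY chain in terms of Majorana operators, in a sector of given parity. -/
theorem majoranaForm_xyMatrix (hL : 2 ≤ L) (γ μ : ℝ) (f : Config L → ℝ)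
    (hf : parityOp L f = σ • f) :
    majoranaForm jwA jwB (xyMatrix L γ θ) f =
      hopping (fun k η => flip η k) (fun k η => bondSign L (-(σ * θ)) k * bondRate γ k η)
        (exitRate μ) f + (L * (μ + 1 / 2)) • f := by
  funext η
  have e1 : ∑ j, ∑ l, shiftMatrix L θ j l * jwB j (jwA l f) η =
      ∑ k, bondSign L (-(σ * θ)) k * f (flip η k) := by
    refine Finset.sum_congr rfl fun j _ => ?_
    rw [← jwB_jwA_bond hL f hf]
    simp [shiftMatrix, ite_mul]
  have e2 : ∑ j, ∑ l, (shiftMatrix L θ).transpose j l * jwB j (jwA l f) η =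
      -∑ k, bondSign L (-(σ * θ)) k * (spin (η k) * spin (η (finRotate L k))) * f (flip η k) := by
    rw [Finset.sum_comm, ← Finset.sum_neg_distrib]
    refine Finset.sum_congr rfl fun j _ => ?_
    rw [← jwB_jwA_bond' hL f hf]
    simp [shiftMatrix, ite_mul]
  have e3 : ∑ j, ∑ l, (1 : Matrix (Fin L) (Fin L) ℝ) j l * jwB j (jwA l f) η =
      -∑ k, spin (η k) * f η := by
    rw [← Finset.sum_neg_distrib]
    refine Finset.sum_congr rfl fun j _ => ?_
    rw [← jwB_jwA_self]
    simp [Matrix.one_apply, ite_mul]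
  have e4 : majoranaForm jwA jwB (xyMatrix L γ θ) f η =
      (1 + γ) / 4 * ∑ j, ∑ l, shiftMatrix L θ j l * jwB j (jwA l f) η +
      (1 - γ) / 4 * ∑ j, ∑ l, (shiftMatrix L θ).transpose j l * jwB j (jwA l f) η -
      1 / 2 * ∑ j, ∑ l, (1 : Matrix (Fin L) (Fin L) ℝ) j l * jwB j (jwA l f) η := by
    rw [majoranaForm_apply]
    simp only [Finset.mul_sum, ← Finset.sum_add_distrib, ← Finset.sum_sub_distrib]
    refine Finset.sum_congr rfl fun j _ => Finset.sum_congr rfl fun l _ => ?_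
    simp only [xyMatrix, Matrix.sub_apply, Matrix.add_apply, Matrix.smul_apply, smul_eq_mul]
    ring
  -- The exit rate is `Lμ + N` and half the sum of the spins is `L/2 - N`, so the diagonal parts
  -- differ by the constant `L (μ + 1/2)`.
  have e5 : exitRate μ η = L * μ + ∑ k, (occ η k : ℝ) := by
    rw [exitRate, Finset.sum_add_distrib, ← Finset.mul_sum, Finset.sum_add_distrib,
      sum_occ_rotate]
    simp only [Finset.sum_const, Finset.card_univ, Fintype.card_fin, nsmul_eq_mul]
    ring
  have e6 : ∑ k, spin (η k) * f η = (L - 2 * ∑ k, (occ η k : ℝ)) * f η := by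
    simp only [spin_eq, ← Finset.sum_mul, Finset.sum_sub_distrib, ← Finset.mul_sum]
    simp
  rw [e4, e1, e2, e3, e6, Pi.add_apply, hopping_apply, Pi.smul_apply, smul_eq_mul, e5]
  have e7 : ∑ k, bondSign L (-(σ * θ)) k * bondRate γ k η * f (flip η k) =
      (1 + γ) / 4 * ∑ k, bondSign L (-(σ * θ)) k * f (flip η k) +
      (1 - γ) / 4 * -∑ k, bondSign L (-(σ * θ)) k *
        (spin (η k) * spin (η (finRotate L k))) * f (flip η k) := by
    rw [mul_neg, ← sub_eq_add_neg, Finset.mul_sum, Finset.mul_sum, ← Finset.sum_sub_distrib]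
    refine Finset.sum_congr rfl fun k _ => ?_
    rw [bondRate]; ring
  rw [e7]; ring

/-! ### Irreducibility -/

/-- Flipping the consecutive bonds from site `0` to site `n + 1` touches every intermediate site
twice. -/
lemma flip_pair_mem (hL : 2 ≤ L) (Z : Config L → Prop) (hZ : ∀ k η, Z η → Z (flip η k))
    (n : ℕ) (hn : n + 1 < L) (η : Config L) (hη : Z η) :
    Z (flipAt ⟨n + 1, hn⟩ (flipAt ⟨0, by omega⟩ η)) := by
  have hrot : ∀ (m : ℕ) (hm : m + 1 < L), finRotate L ⟨m, by omega⟩ = ⟨m + 1, hm⟩ := by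
    intro m hm
    apply Fin.ext
    rw [finRotate_val, if_neg (by simp; omega)]
  induction n with
  | zero =>
    have := hZ ⟨0, by omega⟩ η hη
    rwa [flip_eq_flipAt hL, hrot 0 hn] at this
  | succ n ih =>
    have := hZ ⟨n + 1, by omega⟩ _ (ih (by omega) hrot)
    rwa [flip_eq_flipAt hL, hrot (n + 1) hn, flipAt_involutive] at this

/-- Each disagreement away from site `0` is repaired by flipping it together with site `0`; at the
end equal parity forces agreement at site `0`. The induction is on the number of disagreements. -/
lemma flip_irreducible (hL : 2 ≤ L) (Z : Config L → Prop) (hZ : ∀ k η, Z η → Z (flip η k))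
    (x y : Config L) (hxy : spinProd Finset.univ x = spinProd Finset.univ y) (hx : Z x) : Z y := by
  set o : Fin L := ⟨0, by omega⟩ with ho
  induction hn : (Finset.univ.filter fun j => j ≠ o ∧ x j ≠ y j).card generalizing x with
  | zero =>
    have hd : ∀ j, j ≠ o → x j = y j := by
      intro j hj
      by_contra hne
      have : j ∈ (Finset.univ.filter fun j => j ≠ o ∧ x j ≠ y j) := by simp [hj, hne]
      rw [Finset.card_eq_zero.1 hn] at this
      simp at this
    have : x = y := by
      by_cases h0 : x o = y o
      · funext j
        by_cases hj : j = o
        · rw [hj, h0]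
        · exact hd j hj
      · exfalso
        have hyx : y = flipAt o x := by
          funext j
          rw [flipAt_apply]
          split_ifs with hj
          · rw [hj]
            cases hx0 : x o <;> cases hy0 : y o <;> simp_all
          · exact (hd j hj).symm
        rw [hyx, spinProd_flipAt, if_pos (Finset.mem_univ _)] at hxy
        have := spinProd_mul_self Finset.univ x
        nlinarith
    rwa [← this]
  | succ n ih =>
    obtain ⟨j, hj⟩ : (Finset.univ.filter fun j => j ≠ o ∧ x j ≠ y j).Nonempty := by
      rw [← Finset.card_pos]; omega
    simp only [Finset.mem_filter, Finset.mem_univ, true_and] at hj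
    obtain ⟨m, hm⟩ : ∃ m, (j : ℕ) = m + 1 :=
      Nat.exists_eq_succ_of_ne_zero fun h => hj.1 (Fin.ext h)
    have hjm : j = ⟨m + 1, hm ▸ j.2⟩ := Fin.ext hm
    refine ih (flipAt j (flipAt o x)) ?_ ?_ ?_
    · rw [spinProd_flipAt, spinProd_flipAt, ← hxy]; simp
    · have := flip_pair_mem hL Z hZ m (hm ▸ j.2) x hx
      rwa [← hjm] at this
    · have hset : (Finset.univ.filter fun i => i ≠ o ∧ flipAt j (flipAt o x) i ≠ y i) =
          (Finset.univ.filter fun j => j ≠ o ∧ x j ≠ y j).erase j := by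
        ext i
        simp only [Finset.mem_filter, Finset.mem_univ, true_and, Finset.mem_erase, flipAt_apply]
        by_cases hi : i = o
        · simp [hi]
        · by_cases hij : i = j
          · subst hij
            have := hj.2
            simp only [hi, if_true, if_false]
            cases hx0 : x i <;> cases hy0 : y i <;> simp_all
          · simp [hi, hij]
      rw [hset, Finset.card_erase_of_mem (by simp [hj.1, hj.2]), hn]
      rfl

end JordanWigner

/-! ### Diagonalization of twisted circulant matrices and polar decomposition -/

section Fourier

open Matrix ComplexConjugate

variable {L : ℕ}

/-- The unitary matrix of plane waves `z q ^ j / √L`. -/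
def planeWave (z : Fin L → ℂ) : Matrix (Fin L) (Fin L) ℂ :=
  Matrix.of fun j q => z q ^ (j : ℕ) / (Real.sqrt L : ℂ)

/-- The matrix with eigenvectors the plane waves and eigenvalues `d`. -/
def circulantOf (z d : Fin L → ℂ) : Matrix (Fin L) (Fin L) ℂ :=
  planeWave z * diagonal d * (planeWave z)ᴴ

/-- The momenta: distinct `L`-th roots of `θ` on the unit circle, with an involution that realizes
complex conjugation. -/
structure IsMomenta (z : Fin L → ℂ) (ρ : Equiv.Perm (Fin L)) (θ : ℝ) : Prop where
  pow : ∀ q, z q ^ L = θ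
  norm : ∀ q, ‖z q‖ = 1
  inj : Function.Injective z
  reflect : ∀ q, z (ρ q) = conj (z q)

variable {z : Fin L → ℂ} {ρ : Equiv.Perm (Fin L)} {θ : ℝ} (hz : IsMomenta z ρ θ) (hL : L ≠ 0)

include hz hL

/-- The ratio of two distinct momenta differs from `1` but has `L`-th power `1`, so the geometric
sum vanishes. -/
lemma planeWave_conjTranspose_mul : (planeWave z)ᴴ * planeWave z = 1 := by
  have hL' : ((Real.sqrt L : ℝ) : ℂ) * (Real.sqrt L : ℝ) = L := by
    rw [← Complex.ofReal_mul, Real.mul_self_sqrt (Nat.cast_nonneg _)]; simp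
  have hL0 : (L : ℂ) ≠ 0 := Nat.cast_ne_zero.2 hL
  have hnz : ∀ q, z q ≠ 0 := fun q h => by have := hz.norm q; simp [h] at this
  have hinv : ∀ q, conj (z q) = (z q)⁻¹ := fun q => by
    rw [Complex.inv_def, Complex.normSq_eq_norm_sq, hz.norm]; simp
  ext p q
  rw [mul_apply]
  have h1 : ∀ j : Fin L, (planeWave z)ᴴ p j * planeWave z j q =
      ((z p)⁻¹ * z q) ^ (j : ℕ) / L := fun j => by
    rw [conjTranspose_apply, planeWave, of_apply, of_apply, star_div₀, star_pow,
      ← starRingEnd_apply, hinv, ← starRingEnd_apply, Complex.conj_ofReal, div_mul_div_comm,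
      ← mul_pow, hL']
  rw [Finset.sum_congr rfl fun j _ => h1 j, ← Finset.sum_div,
    Fin.sum_univ_eq_sum_range (fun j => ((z p)⁻¹ * z q) ^ j) L, one_apply]
  split_ifs with h
  · subst h
    rw [inv_mul_cancel₀ (hnz p)]; simp [hL0]
  · have hne : (z p)⁻¹ * z q ≠ 1 := fun h' => h (hz.inj (by
      rw [inv_mul_eq_one₀ (hnz p)] at h'; exact h'))
    rw [geom_sum_eq hne, mul_pow, inv_pow, hz.pow, hz.pow]
    have : (θ : ℂ) ≠ 0 := by rw [← hz.pow p]; exact pow_ne_zero _ (hnz p)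
    rw [inv_mul_cancel₀ this]; simp

lemma circulantOf_mul (d e : Fin L → ℂ) :
    circulantOf z d * circulantOf z e = circulantOf z (fun q => d q * e q) := by
  have h := planeWave_conjTranspose_mul hz hL
  unfold circulantOf
  calc _ = planeWave z * diagonal d * ((planeWave z)ᴴ * planeWave z) * diagonal e *
        (planeWave z)ᴴ := by simp only [Matrix.mul_assoc]
    _ = _ := by rw [h, Matrix.mul_one, Matrix.mul_assoc (planeWave z), diagonal_mul_diagonal]

lemma circulantOf_one : circulantOf z (fun _ => 1) = 1 := by
  unfold circulantOf
  rw [diagonal_one, Matrix.mul_one]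
  exact mul_eq_one_comm.1 (planeWave_conjTranspose_mul hz hL)

lemma trace_circulantOf (d : Fin L → ℂ) : (circulantOf z d).trace = ∑ q, d q := by
  unfold circulantOf
  rw [Matrix.trace_mul_comm, ← Matrix.mul_assoc, planeWave_conjTranspose_mul hz hL, Matrix.one_mul,
    trace_diagonal]

omit hz hL in
lemma conjTranspose_circulantOf (d : Fin L → ℂ) :
    (circulantOf z d)ᴴ = circulantOf z (fun q => conj (d q)) := by
  unfold circulantOf
  rw [conjTranspose_mul, conjTranspose_mul, conjTranspose_conjTranspose, diagonal_conjTranspose,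
    Matrix.mul_assoc]
  rfl

-- The involution `ρ` pairs each summand with its complex conjugate. Reality is essential, since the
-- Majorana estimates need real matrices.
omit hL in
lemma circulantOf_real (d : Fin L → ℂ) (hd : ∀ q, d (ρ q) = conj (d q)) :
    ((circulantOf z d).map Complex.re).map ((↑) : ℝ → ℂ) = circulantOf z d := by
  have hE : ∀ j q, planeWave z j (ρ q) = conj (planeWave z j q) := fun j q => by
    simp [planeWave, hz.reflect]
  ext j l
  rw [map_apply, map_apply]
  refine Complex.conj_eq_iff_re.1 ?_
  have h1 : circulantOf z d j l = ∑ q, planeWave z j q * d q * conj (planeWave z l q) := by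
    unfold circulantOf
    rw [mul_apply]
    refine Finset.sum_congr rfl fun q _ => ?_
    rw [mul_diagonal, conjTranspose_apply]; rfl
  rw [h1, map_sum, ← Equiv.sum_comp ρ (fun q => planeWave z j q * d q * conj (planeWave z l q))]
  refine Finset.sum_congr rfl fun q _ => ?_
  rw [hE, hE, hd, map_mul, map_mul]

-- Plane waves are eigenvectors of the shift; at the wrap-around the twist `θ` is matched by `z q ^
-- L = θ`.
omit hL in
lemma shiftMatrix_eq_circulantOf (hL2 : 2 ≤ L) :
    (shiftMatrix L θ).map ((↑) : ℝ → ℂ) = circulantOf z z := by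
  have h := planeWave_conjTranspose_mul hz (by omega)
  have h' : planeWave z * (planeWave z)ᴴ = 1 := mul_eq_one_comm.1 h
  have key : (shiftMatrix L θ).map ((↑) : ℝ → ℂ) * planeWave z = planeWave z * diagonal z := by
    ext j q
    rw [mul_diagonal, mul_apply, Finset.sum_eq_single (finRotate L j)]
    · simp only [shiftMatrix, map_apply, of_apply, if_true, planeWave, finRotate_val, bondSign]
      split_ifs with hj
      · rw [div_mul_eq_mul_div, ← pow_succ, hj, hz.pow]; simp [div_eq_mul_inv]
      · rw [div_mul_eq_mul_div, ← pow_succ]; simp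
    · intro l _ hl
      simp only [shiftMatrix, map_apply, of_apply]
      rw [if_neg hl]; simp
    · simp
  unfold circulantOf
  rw [← key, Matrix.mul_assoc, h', Matrix.mul_one]

omit hz hL in
lemma circulantOf_linear (a b c : ℂ) (d e f : Fin L → ℂ) :
    a • circulantOf z d + b • circulantOf z e - c • circulantOf z f =
      circulantOf z (fun q => a * d q + b * e q - c * f q) := by
  have h : diagonal (fun q => a * d q + b * e q - c * f q) =
      a • diagonal d + b • diagonal e - c • diagonal f := by
    ext i j
    by_cases hij : i = j
    · subst hij; simp
    · simp [diagonal_apply_ne _ hij]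
  unfold circulantOf
  rw [h, Matrix.mul_sub, Matrix.mul_add, Matrix.sub_mul, Matrix.add_mul]
  simp only [Matrix.mul_smul, Matrix.smul_mul]

/-- The symbol of the XY chain. -/
def xySymbol (γ : ℝ) (w : ℂ) : ℂ := ((1 + γ) / 4 : ℝ) * w + ((1 - γ) / 4 : ℝ) * conj w - (1 / 2 : ℝ)

omit hL in
lemma xyMatrix_eq_circulantOf (hL2 : 2 ≤ L) (γ : ℝ) :
    (xyMatrix L γ θ).map ((↑) : ℝ → ℂ) = circulantOf z (fun q => xySymbol γ (z q)) := by
  have h1 := shiftMatrix_eq_circulantOf hz hL2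
  have h2 : ((shiftMatrix L θ).transpose).map ((↑) : ℝ → ℂ) =
      circulantOf z (fun q => conj (z q)) := by
    rw [← conjTranspose_circulantOf, ← h1]
    ext i j
    simp
  have h3 := circulantOf_one hz (by omega)
  have h4 := circulantOf_linear (z := z) ((1 + γ) / 4 : ℝ) ((1 - γ) / 4 : ℝ) (1 / 2 : ℝ) z
    (fun q => conj (z q)) (fun _ => 1)
  rw [← h1, ← h2, h3] at h4
  have h5 : (fun q => xySymbol γ (z q)) = fun q => ((1 + γ) / 4 : ℝ) * z q +
      ((1 - γ) / 4 : ℝ) * conj (z q) - (1 / 2 : ℝ) * (1 : ℂ) := by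
    funext q; simp [xySymbol]
  rw [h5, ← h4]
  ext i j
  simp only [xyMatrix, Matrix.one_apply, map_apply, Matrix.sub_apply, Matrix.add_apply,
    Matrix.smul_apply, smul_eq_mul]
  split_ifs <;> simp

omit hL in
/-- Polar decomposition of the coefficient matrix of the XY chain. -/
theorem xyMatrix_polar (hL2 : 2 ≤ L) (γ : ℝ) :
    ∃ U W R : Matrix (Fin L) (Fin L) ℝ, U * Uᵀ = 1 ∧ W * R = xyMatrix L γ θ ∧
      ((W * Wᵀ).trace + (R * Rᵀ).trace) / 2 = ∑ q, ‖xySymbol γ (z q)‖ ∧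
      (xyMatrix L γ θ * Uᵀ).trace = ∑ q, ‖xySymbol γ (z q)‖ := by
  have hL0 : L ≠ 0 := by omega
  set m : Fin L → ℂ := fun q => xySymbol γ (z q) with hm
  have hmρ : ∀ q, m (ρ q) = conj (m q) := fun q => by
    simp only [hm, xySymbol, hz.reflect, map_sub, map_add, map_mul, Complex.conj_ofReal]
  -- The phase is set to `1` where the symbol vanishes, as at momentum zero, so that the polar
  -- factor is still orthogonal.
  set u : Fin L → ℂ := fun q => if m q = 0 then 1 else m q / ‖m q‖ with hu
  have huρ : ∀ q, u (ρ q) = conj (u q) := fun q => by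
    simp only [hu, hmρ]
    by_cases h : m q = 0 <;> simp [h]
  have huu : ∀ q, u q * conj (u q) = 1 := fun q => by
    simp only [hu]
    split_ifs with h
    · simp
    · have : (‖m q‖ : ℂ) ≠ 0 := by simpa using h
      rw [map_div₀, div_mul_div_comm, Complex.mul_conj', Complex.conj_ofReal, ← sq,
        div_self (pow_ne_zero 2 this)]
  have hum : ∀ q, u q * ‖m q‖ = m q := fun q => by
    simp only [hu]
    split_ifs with h
    · simp [h]
    · have : (‖m q‖ : ℂ) ≠ 0 := by simpa using h
      rw [div_mul_cancel₀ _ this]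
  have hmu : ∀ q, m q * conj (u q) = ‖m q‖ := fun q => by
    rw [← hum q, mul_right_comm, huu, one_mul, norm_mul]
    have : ‖u q‖ = 1 := by
      have h := congrArg norm (huu q)
      rw [norm_mul, Complex.norm_conj, norm_one] at h
      nlinarith [norm_nonneg (u q)]
    simp [this]
  -- The factors `W = U |M|^(1/2)` and `R = |M|^(1/2)` turn the bound of `form_le` into the trace
  -- norm itself.
  set r : Fin L → ℂ := fun q => (Real.sqrt ‖m q‖ : ℝ) with hr
  have hrρ : ∀ q, r (ρ q) = conj (r q) := fun q => by
    simp [hr, hmρ]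
  have hrr : ∀ q, r q * r q = ‖m q‖ := fun q => by
    simp only [hr]
    rw [← Complex.ofReal_mul, Real.mul_self_sqrt (norm_nonneg _)]
  have hrc : ∀ q, conj (r q) = r q := fun q => by simp [hr]
  have hwρ : ∀ q, u (ρ q) * r (ρ q) = conj (u q * r q) := fun q => by
    rw [huρ, hrρ, map_mul]
  have hU := circulantOf_real hz u huρ
  have hW := circulantOf_real hz (fun q => u q * r q) hwρ
  have hR := circulantOf_real hz r hrρ
  have hM := xyMatrix_eq_circulantOf hz hL2 γ
  have hT : ∀ N : Matrix (Fin L) (Fin L) ℝ,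
      (Nᵀ).map ((↑) : ℝ → ℂ) = (N.map ((↑) : ℝ → ℂ))ᴴ := fun N => by ext i j; simp
  have hmul : ∀ N N' : Matrix (Fin L) (Fin L) ℝ, (N * N').map ((↑) : ℝ → ℂ) =
      N.map ((↑) : ℝ → ℂ) * N'.map ((↑) : ℝ → ℂ) := fun N N' =>
    Matrix.map_mul (f := Complex.ofRealHom)
  have htr : ∀ N : Matrix (Fin L) (Fin L) ℝ, ((N.trace : ℝ) : ℂ) =
      (N.map ((↑) : ℝ → ℂ)).trace := fun N => by simp [Matrix.trace]
  have hinj : Function.Injective fun N : Matrix (Fin L) (Fin L) ℝ => N.map ((↑) : ℝ → ℂ) :=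
    Matrix.map_injective Complex.ofReal_injective
  refine ⟨(circulantOf z u).map Complex.re, (circulantOf z fun q => u q * r q).map Complex.re,
    (circulantOf z r).map Complex.re, hinj ?_, hinj ?_, Complex.ofReal_injective ?_,
    Complex.ofReal_injective ?_⟩
  · dsimp only
    rw [hmul, hT, hU, conjTranspose_circulantOf, circulantOf_mul hz hL0]
    simp only [huu]
    rw [circulantOf_one hz hL0]
    ext i j
    rw [map_apply, Matrix.one_apply, Matrix.one_apply]
    split_ifs <;> simp
  · dsimp only
    rw [hmul, hW, hR, circulantOf_mul hz hL0, hM]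
    congr 1
    funext q
    rw [mul_assoc, hrr, hum]
  · push_cast
    rw [htr, htr, hmul, hmul, hT, hT, hW, hR, conjTranspose_circulantOf, conjTranspose_circulantOf,
      circulantOf_mul hz hL0, circulantOf_mul hz hL0, trace_circulantOf hz hL0,
      trace_circulantOf hz hL0]
    have h1 : ∀ q, u q * r q * conj (u q * r q) = ‖m q‖ := fun q => by
      rw [map_mul, hrc, mul_mul_mul_comm, huu, one_mul, hrr]
    simp only [h1, hrc, hrr]
    ring
  · push_cast
    rw [htr, hmul, hT, hU, hM, conjTranspose_circulantOf, circulantOf_mul hz hL0,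
      trace_circulantOf hz hL0]
    exact Finset.sum_congr rfl fun q _ => hmu q

end Fourier

/-! ### Allowed momenta and the dispersion relation -/

section Momenta

open ComplexConjugate

/-- The momenta `2 π (q + δ) / L`. -/
def momentum (L : ℕ) (δ : ℝ) (q : Fin L) : ℂ :=
  Complex.exp ((2 * Real.pi * ((q + δ) / L) : ℝ) * Complex.I)

lemma momentum_eq_iff {L : ℕ} {δ δ' : ℝ} (hL : L ≠ 0) (p q : Fin L) :
    Complex.exp ((2 * Real.pi * ((p + δ) / L) : ℝ) * Complex.I) =
      Complex.exp ((2 * Real.pi * ((q + δ') / L) : ℝ) * Complex.I) ↔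
      ∃ n : ℤ, (p : ℝ) + δ = q + δ' + n * L := by
  have hL' : (L : ℝ) ≠ 0 := Nat.cast_ne_zero.2 hL
  rw [Complex.exp_eq_exp_iff_exists_int]
  refine exists_congr fun n => ?_
  have : (2 * Real.pi * ((q + δ') / L) : ℝ) * Complex.I + n * (2 * Real.pi * Complex.I) =
      ((2 * Real.pi * ((q + δ') / L) + n * (2 * Real.pi) : ℝ)) * Complex.I := by
    push_cast; ring
  rw [this, mul_left_inj' Complex.I_ne_zero, Complex.ofReal_inj]
  have hpi := Real.pi_pos.ne'
  constructor
  · intro h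
    field_simp at h
    linarith
  · intro h
    rw [h]
    field_simp

lemma isMomenta_of_involutive {L : ℕ} (hL : L ≠ 0) {δ θ : ℝ}
    (hθ : Complex.exp ((2 * Real.pi * δ : ℝ) * Complex.I) = θ) (ρ : Equiv.Perm (Fin L))
    (hρ : ∀ q, ∃ n : ℤ, ((ρ q : ℕ) : ℝ) + δ = -(q + δ) + n * L) :
    IsMomenta (momentum L δ) ρ θ where
  pow q := by
    have hL' : (L : ℂ) ≠ 0 := Nat.cast_ne_zero.2 hL
    rw [momentum, ← Complex.exp_nat_mul, ← hθ, Complex.exp_eq_exp_iff_exists_int]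
    refine ⟨q, ?_⟩
    push_cast
    field_simp
    ring
  norm q := by rw [momentum, Complex.norm_exp_ofReal_mul_I]
  inj p q h := by
    obtain ⟨n, hn⟩ := (momentum_eq_iff hL p q).1 h
    have h1 : (p : ℤ) = q + n * L := by
      have : ((p : ℤ) : ℝ) = ((q + n * L : ℤ) : ℝ) := by push_cast; linarith
      exact_mod_cast this
    have h2 := p.2
    have h3 := q.2
    have : n = 0 := by
      by_contra h0
      rcases lt_or_gt_of_ne h0 with h | h <;> nlinarith
    subst this
    exact Fin.ext (by omega)
  reflect q := by
    obtain ⟨n, hn⟩ := hρ q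
    have hL' : (L : ℂ) ≠ 0 := Nat.cast_ne_zero.2 hL
    rw [momentum, momentum, ← Complex.exp_conj, map_mul, Complex.conj_ofReal, Complex.conj_I,
      Complex.exp_eq_exp_iff_exists_int]
    refine ⟨n, ?_⟩
    rw [hn]
    push_cast
    field_simp


lemma isMomenta_antiperiodic {L : ℕ} (hL : L ≠ 0) :
    IsMomenta (momentum L (1 / 2)) Fin.revPerm (-1) :=
  isMomenta_of_involutive hL
    (by
      have : ((2 * Real.pi * (1 / 2) : ℝ) : ℂ) = Real.pi := by push_cast; ring
      rw [this, Complex.exp_pi_mul_I]; simp)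
    _ fun q => ⟨1, by
      have : ((Fin.rev q : Fin L) : ℕ) + (q + 1) = L := by rw [Fin.val_rev]; omega
      have h : (((Fin.rev q : Fin L) : ℕ) : ℝ) + (q + 1) = L := by exact_mod_cast this
      simp only [Fin.revPerm_apply]
      push_cast
      linarith⟩

lemma isMomenta_periodic {L : ℕ} [NeZero L] :
    IsMomenta (momentum L 0) (Equiv.neg (Fin L)) 1 :=
  isMomenta_of_involutive (NeZero.ne L) (by simp) _ fun q => by
    by_cases h : q = 0
    · exact ⟨0, by simp [h]⟩
    · refine ⟨1, ?_⟩
      have h1 : ((-q : Fin L) : ℕ) + q = L := by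
        rw [Fin.val_neg]
        rw [if_neg h]; omega
      have h2 : (((-q : Fin L) : ℕ) : ℝ) + q = L := by exact_mod_cast h1
      simp only [Equiv.neg_apply]
      push_cast
      linarith

/-- Half of the dispersion relation, as a function of `k / (2 π)`. -/
def dispersion (ν x : ℝ) : ℝ :=
  Real.sin (Real.pi * x) * Real.sqrt (1 - ν ^ 2 * Real.cos (Real.pi * x) ^ 2)

/-- With `s` and `c` the sine and cosine of `πx`, the symbol is `-s² + iγsc`, whose squared modulus
is `s² (s² + γ² c²)`; on `[0, 1]` the sine is nonnegative. -/
lemma norm_xySymbol {ν γ : ℝ} (hγ : γ ^ 2 = 1 - ν ^ 2) {x : ℝ} (hx0 : 0 ≤ x) (hx1 : x ≤ 1) :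
    ‖xySymbol γ (Complex.exp ((2 * Real.pi * x : ℝ) * Complex.I))‖ = dispersion ν x := by
  have hs : 0 ≤ Real.sin (Real.pi * x) :=
    Real.sin_nonneg_of_nonneg_of_le_pi (by positivity) (by nlinarith [Real.pi_pos])
  set s := Real.sin (Real.pi * x) with hsdef
  set c := Real.cos (Real.pi * x) with hcdef
  have hsc : s ^ 2 + c ^ 2 = 1 := Real.sin_sq_add_cos_sq _
  have e1 : Real.cos (2 * Real.pi * x) = 2 * c ^ 2 - 1 := by
    rw [mul_assoc, Real.cos_two_mul]
  have e2 : Real.sin (2 * Real.pi * x) = 2 * s * c := by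
    rw [mul_assoc, Real.sin_two_mul]
  have hν : 0 ≤ 1 - ν ^ 2 * c ^ 2 := by nlinarith [sq_nonneg γ, sq_nonneg (ν * s), sq_nonneg s]
  rw [Complex.norm_def, dispersion, ← hsdef, ← hcdef]
  have e3 : Complex.normSq (xySymbol γ (Complex.exp ((2 * Real.pi * x : ℝ) * Complex.I))) =
      s ^ 2 * (1 - ν ^ 2 * c ^ 2) := by
    rw [Complex.exp_mul_I, ← Complex.ofReal_cos, ← Complex.ofReal_sin, e1, e2]
    rw [Complex.normSq_apply]
    simp only [xySymbol, Complex.add_re, Complex.sub_re, Complex.add_im, Complex.sub_im,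
      Complex.mul_re, Complex.mul_im, Complex.ofReal_re, Complex.ofReal_im, Complex.I_re,
      Complex.I_im, Complex.conj_re, Complex.conj_im]
    linear_combination (c ^ 2 - 1) * hsc + s ^ 2 * c ^ 2 * hγ
  rw [e3, Real.sqrt_mul (sq_nonneg s), Real.sqrt_sq hs]

end Momenta

/-! ### Midpoint and trapezoidal rules with error terms -/

section Quadrature

/-- The mean value inequality raises the order by one at the cost of the factor `1/(n+1)`; iterating
it replaces Taylor's formula with remainder. -/
lemma abs_le_pow_succ_of_deriv {ψ ψ' : ℝ → ℝ} (h0 : ψ 0 = 0) (hψ : ∀ t, HasDerivAt ψ (ψ' t) t)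
    {C T : ℝ} (hC : 0 ≤ C) (n : ℕ) (hb : ∀ t, 0 ≤ t → t ≤ T → |ψ' t| ≤ C * t ^ n) :
    ∀ t, 0 ≤ t → t ≤ T → |ψ t| ≤ C * t ^ (n + 1) := by
  intro t ht htT
  have := norm_image_sub_le_of_norm_deriv_le_segment' (f := ψ) (f' := ψ') (a := 0) (b := t)
    (C := C * t ^ n) (fun x _ => (hψ x).hasDerivWithinAt) (fun x hx => by
      refine (hb x hx.1 (hx.2.le.trans htT)).trans ?_
      have := hx.1
      have := hx.2.le
      gcongr) t ⟨ht, le_rfl⟩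
  rw [h0, sub_zero, sub_zero, Real.norm_eq_abs] at this
  rw [pow_succ, ← mul_assoc]
  exact this

lemma hasDerivAt_comp_add {f : ℝ → ℝ} {f' m t : ℝ} (h : HasDerivAt f f' (m + t)) :
    HasDerivAt (fun t => f (m + t)) f' t := h.comp_const_add m t

lemma hasDerivAt_comp_sub {f : ℝ → ℝ} {f' m t : ℝ} (h : HasDerivAt f f' (m - t)) :
    HasDerivAt (fun t => f (m - t)) (-f') t := h.comp_const_sub m t

variable {G g g1 g2 g3 g4 : ℝ → ℝ} (hG : ∀ x, HasDerivAt G (g x) x)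
  (hg : ∀ x, HasDerivAt g (g1 x) x) (hg1 : ∀ x, HasDerivAt g1 (g2 x) x)
  (hg2 : ∀ x, HasDerivAt g2 (g3 x) x) (hg3 : ∀ x, HasDerivAt g3 (g4 x) x)

include hg2 hg3 in
lemma second_difference_le {C m T : ℝ} (hC : 0 ≤ C)
    (hb : ∀ x, m - T ≤ x → x ≤ m + T → |g4 x| ≤ C) (t : ℝ) (ht : 0 ≤ t) (htT : t ≤ T) :
    |g2 (m + t) + g2 (m - t) - 2 * g2 m| ≤ 2 * C * t ^ 2 := by
  refine abs_le_pow_succ_of_deriv (ψ := fun t => g2 (m + t) + g2 (m - t) - 2 * g2 m)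
    (ψ' := fun t => g3 (m + t) - g3 (m - t)) (by simp; ring)
    (fun t => ?_) (by positivity) 1 (T := T) ?_ t ht htT
  · simpa [sub_eq_add_neg] using ((hasDerivAt_comp_add (hg2 (m + t))).add
      (hasDerivAt_comp_sub (hg2 (m - t)))).sub_const (2 * g2 m)
  · refine abs_le_pow_succ_of_deriv (ψ := fun t => g3 (m + t) - g3 (m - t))
      (ψ' := fun t => g4 (m + t) + g4 (m - t)) (by simp) (fun t => ?_) (by positivity) 0 ?_
    · exact ((hasDerivAt_comp_add (hg3 (m + t))).sub
        (hasDerivAt_comp_sub (hg3 (m - t)))).congr_deriv (by ring)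
    · intro t ht htT
      have h1 := hb (m + t) (by linarith) (by linarith)
      have h2 := hb (m - t) (by linarith) (by linarith)
      have := abs_add_le (g4 (m + t)) (g4 (m - t))
      simp only [pow_zero, mul_one]
      linarith

include hg hg1 hg2 hg3 in
lemma symmetric_taylor_le {C m T : ℝ} (hC : 0 ≤ C)
    (hb : ∀ x, m - T ≤ x → x ≤ m + T → |g4 x| ≤ C) (t : ℝ) (ht : 0 ≤ t) (htT : t ≤ T) :
    |g (m + t) + g (m - t) - 2 * g m - g2 m * t ^ 2| ≤ 2 * C * t ^ 4 := by
  refine abs_le_pow_succ_of_deriv (ψ := fun t => g (m + t) + g (m - t) - 2 * g m - g2 m * t ^ 2)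
    (ψ' := fun t => g1 (m + t) - g1 (m - t) - 2 * g2 m * t) (by simp; ring)
    (fun t => ?_) (by positivity) 3 (T := T) ?_ t ht htT
  · have h := (((hasDerivAt_comp_add (hg (m + t))).add
      (hasDerivAt_comp_sub (hg (m - t)))).sub_const (2 * g m)).sub
      (((hasDerivAt_id t).pow 2).const_mul (g2 m))
    exact h.congr_deriv (by simp; ring)
  · refine abs_le_pow_succ_of_deriv (ψ := fun t => g1 (m + t) - g1 (m - t) - 2 * g2 m * t)
      (ψ' := fun t => g2 (m + t) + g2 (m - t) - 2 * g2 m) (by simp) (fun t => ?_)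
      (by positivity) 2 ?_
    · have h := ((hasDerivAt_comp_add (hg1 (m + t))).sub
        (hasDerivAt_comp_sub (hg1 (m - t)))).sub ((hasDerivAt_id t).const_mul (2 * g2 m))
      exact h.congr_deriv (by simp)
    · exact second_difference_le hg2 hg3 hC hb

include hG hg hg1 hg2 hg3 in
lemma midpoint_cell_le {C m T : ℝ} (hC : 0 ≤ C)
    (hb : ∀ x, m - T ≤ x → x ≤ m + T → |g4 x| ≤ C) (t : ℝ) (ht : 0 ≤ t) (htT : t ≤ T) :
    |G (m + t) - G (m - t) - 2 * t * g m - g2 m * t ^ 3 / 3| ≤ 2 * C * t ^ 5 := by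
  refine abs_le_pow_succ_of_deriv
    (ψ := fun t => G (m + t) - G (m - t) - 2 * t * g m - g2 m * t ^ 3 / 3)
    (ψ' := fun t => g (m + t) + g (m - t) - 2 * g m - g2 m * t ^ 2) (by simp)
    (fun t => ?_) (by positivity) 4 (T := T) (symmetric_taylor_le hg hg1 hg2 hg3 hC hb) t ht htT
  have h := (((hasDerivAt_comp_add (hG (m + t))).sub (hasDerivAt_comp_sub (hG (m - t)))).sub
    (((hasDerivAt_id t).const_mul 2).mul_const (g m))).sub
    ((((hasDerivAt_id t).pow 3).const_mul (g2 m)).div_const 3)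
  exact h.congr_deriv (by simp; ring)

include hg1 hg2 hg3 in
lemma derivative_cell_le {C m T : ℝ} (hC : 0 ≤ C)
    (hb : ∀ x, m - T ≤ x → x ≤ m + T → |g4 x| ≤ C) (t : ℝ) (ht : 0 ≤ t) (htT : t ≤ T) :
    |g1 (m + t) - g1 (m - t) - 2 * t * g2 m| ≤ 2 * C * t ^ 3 := by
  refine abs_le_pow_succ_of_deriv (ψ := fun t => g1 (m + t) - g1 (m - t) - 2 * t * g2 m)
    (ψ' := fun t => g2 (m + t) + g2 (m - t) - 2 * g2 m) (by simp)
    (fun t => ?_) (by positivity) 2 (T := T) (second_difference_le hg2 hg3 hC hb) t ht htT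
  have h := ((hasDerivAt_comp_add (hg1 (m + t))).sub (hasDerivAt_comp_sub (hg1 (m - t)))).sub
    (((hasDerivAt_id t).const_mul 2).mul_const (g2 m))
  exact h.congr_deriv (by simp)

include hG hg hg1 hg2 hg3 in
/-- Second-order Euler–Maclaurin formulas for the midpoint rule and the trapezoidal rule. -/
theorem quadrature_le {C : ℝ} (hC : 0 ≤ C) (hb : ∀ x, 0 ≤ x → x ≤ 1 → |g4 x| ≤ C)
    (hper : g 0 = g 1) (L : ℕ) (hL : L ≠ 0) :
    |(∑ q ∈ Finset.range L, g ((q + 1 / 2) / L)) / L -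
        (G 1 - G 0 - (g1 1 - g1 0) / 24 / (L : ℝ) ^ 2)| ≤ C / (L : ℝ) ^ 4 ∧
    |(∑ q ∈ Finset.range L, g (q / L)) / L -
        (G 1 - G 0 + (g1 1 - g1 0) / 12 / (L : ℝ) ^ 2)| ≤ C / (L : ℝ) ^ 4 := by
  have hLpos : (0 : ℝ) < L := by exact_mod_cast Nat.pos_of_ne_zero hL
  set t : ℝ := 1 / (2 * L) with ht
  have ht0 : 0 ≤ t := by positivity
  set m : ℕ → ℝ := fun q => (q + 1 / 2) / L with hm
  have hmp : ∀ q : ℕ, m q + t = ((q + 1 : ℕ) : ℝ) / L := fun q => by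
    simp only [hm, ht]; push_cast; field_simp; ring
  have hmm : ∀ q : ℕ, m q - t = (q : ℝ) / L := fun q => by
    simp only [hm, ht]; field_simp; ring
  have hbm : ∀ q ∈ Finset.range L, ∀ x, m q - t ≤ x → x ≤ m q + t → |g4 x| ≤ C := by
    intro q hq x h1 h2
    rw [hmm] at h1
    rw [hmp] at h2
    have hq' : ((q + 1 : ℕ) : ℝ) ≤ L := by exact_mod_cast Finset.mem_range.1 hq
    exact hb x (le_trans (by positivity) h1) (h2.trans ((div_le_one hLpos).2 hq'))
  have htel : ∀ F : ℝ → ℝ, ∑ q ∈ Finset.range L, (F (m q + t) - F (m q - t)) = F 1 - F 0 := by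
    intro F
    simp only [hmp, hmm]
    rw [Finset.sum_range_sub (fun q : ℕ => F ((q : ℝ) / L))]
    simp [hLpos.ne']
  set Sg := ∑ q ∈ Finset.range L, g (m q) with hSg
  set S2 := ∑ q ∈ Finset.range L, g2 (m q) with hS2
  set St := ∑ q ∈ Finset.range L, g ((q : ℝ) / L) with hSt
  have key : ∀ (F : ℕ → ℝ) (e : ℝ), (∀ q ∈ Finset.range L, |F q| ≤ e) →
      |∑ q ∈ Finset.range L, F q| ≤ L * e := fun F e hF => by
    refine (Finset.abs_sum_le_sum_abs _ _).trans ((Finset.sum_le_sum hF).trans ?_)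
    simp
  have k1 := key _ _ fun q hq => midpoint_cell_le hG hg hg1 hg2 hg3 hC (hbm q hq) t ht0 le_rfl
  have k2 := key _ _ fun q hq => derivative_cell_le hg1 hg2 hg3 hC (hbm q hq) t ht0 le_rfl
  have k3 := key _ _ fun q hq => symmetric_taylor_le hg hg1 hg2 hg3 hC (hbm q hq) t ht0 le_rfl
  have e1 : ∑ q ∈ Finset.range L,
      (G (m q + t) - G (m q - t) - 2 * t * g (m q) - g2 (m q) * t ^ 3 / 3) =
      G 1 - G 0 - 2 * t * Sg - S2 * t ^ 3 / 3 := by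
    rw [Finset.sum_sub_distrib, Finset.sum_sub_distrib, htel, ← Finset.mul_sum, ← Finset.sum_div,
      ← Finset.sum_mul]
  have e2 : ∑ q ∈ Finset.range L, (g1 (m q + t) - g1 (m q - t) - 2 * t * g2 (m q)) =
      g1 1 - g1 0 - 2 * t * S2 := by
    rw [Finset.sum_sub_distrib, htel, ← Finset.mul_sum]
  have e3 : ∑ q ∈ Finset.range L,
      (g (m q + t) + g (m q - t) - 2 * g (m q) - g2 (m q) * t ^ 2) =
      2 * St - 2 * Sg - S2 * t ^ 2 := by
    -- The right and left endpoint sums differ by `g 1 - g 0 = 0`.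
    have hp : ∑ q ∈ Finset.range L, g (m q + t) = St := by
      have := htel g
      rw [Finset.sum_sub_distrib, hper, sub_self, sub_eq_zero] at this
      rw [this]
      simp only [hmm]; rfl
    have hmi : ∑ q ∈ Finset.range L, g (m q - t) = St := by simp only [hmm]; rfl
    rw [Finset.sum_sub_distrib, Finset.sum_sub_distrib, Finset.sum_add_distrib, hp, hmi,
      ← Finset.mul_sum, ← Finset.sum_mul]
    ring
  rw [e1] at k1
  rw [e2] at k2
  rw [e3] at k3
  set x : ℝ := (L : ℝ)⁻¹ with hx
  have hx0 : 0 < x := inv_pos.2 hLpos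
  have htx : t = x / 2 := by rw [ht, hx]; field_simp
  have hLx : (L : ℝ) * x = 1 := mul_inv_cancel₀ hLpos.ne'
  rw [htx] at k1 k2 k3
  have k1' : |G 1 - G 0 - x * Sg - S2 * x ^ 3 / 24| ≤ C / 16 * x ^ 4 := by
    calc _ = |G 1 - G 0 - 2 * (x / 2) * Sg - S2 * (x / 2) ^ 3 / 3| := by congr 1; ring
      _ ≤ _ := k1
      _ = C / 16 * x ^ 4 * (L * x) := by ring
      _ = _ := by rw [hLx, mul_one]
  have k2' : |g1 1 - g1 0 - x * S2| ≤ C / 4 * x ^ 2 := by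
    calc _ = |g1 1 - g1 0 - 2 * (x / 2) * S2| := by congr 1; ring
      _ ≤ _ := k2
      _ = C / 4 * x ^ 2 * (L * x) := by ring
      _ = _ := by rw [hLx, mul_one]
  have k3' : |x * St - x * Sg - S2 * x ^ 3 / 8| ≤ C / 16 * x ^ 4 := by
    have : x * St - x * Sg - S2 * x ^ 3 / 8 = x / 2 * (2 * St - 2 * Sg - S2 * (x / 2) ^ 2) := by
      ring
    rw [this, abs_mul, abs_of_pos (by positivity)]
    calc _ ≤ x / 2 * (L * (2 * C * (x / 2) ^ 4)) := by gcongr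
      _ = C / 16 * x ^ 4 * (L * x) := by ring
      _ = _ := by rw [hLx, mul_one]
  -- Scaled by `x²`, this bound eliminates `S2`, whose coefficient is `-1/24` for the midpoint rule
  -- and `-1/24 + 1/8 = 1/12` for the trapezoidal rule.
  have k2'' : |x ^ 2 * (g1 1 - g1 0) - x ^ 3 * S2| ≤ C / 4 * x ^ 4 := by
    have : x ^ 2 * (g1 1 - g1 0) - x ^ 3 * S2 = x ^ 2 * (g1 1 - g1 0 - x * S2) := by ring
    rw [this, abs_mul, abs_of_pos (by positivity)]
    calc _ ≤ x ^ 2 * (C / 4 * x ^ 2) := by gcongr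
      _ = _ := by ring
  have hCx : 0 ≤ C * x ^ 4 := by positivity
  have d4 : C / (L : ℝ) ^ 4 = C * x ^ 4 := by rw [hx, inv_pow, div_eq_mul_inv]
  have d2 : ∀ y : ℝ, y / (L : ℝ) ^ 2 = y * x ^ 2 := fun y => by rw [hx, inv_pow, div_eq_mul_inv]
  have d1 : ∀ y : ℝ, y / (L : ℝ) = x * y := fun y => by rw [hx, div_eq_mul_inv, mul_comm]
  rw [d4, d2, d2, d1, d1]
  rw [abs_le] at k1' k2'' k3'
  constructor
  · rw [abs_le]
    constructor <;> linarith
  · rw [abs_le]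
    constructor <;> linarith

end Quadrature

/-! ### Integral and boundary derivatives of the dispersion relation -/

section Dispersion

variable {ν : ℝ}

lemma radicand_pos (hν₀ : 0 ≤ ν) (hν₁ : ν < 1) (u : ℝ) (hu : |u| ≤ 1) : 0 < 1 - ν ^ 2 * u ^ 2 := by
  have h1 : u ^ 2 ≤ 1 := by rw [← sq_abs]; exact pow_le_one₀ (abs_nonneg u) hu
  nlinarith [sq_nonneg ν, sq_nonneg u]

lemma contDiff_sqrt_radicand (hν₀ : 0 ≤ ν) (hν₁ : ν < 1) :
    ContDiff ℝ 4 fun x : ℝ => Real.sqrt (1 - ν ^ 2 * Real.cos (Real.pi * x) ^ 2) := by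
  refine ContDiff.sqrt ?_ fun x => (radicand_pos hν₀ hν₁ _ (Real.abs_cos_le_one _)).ne'
  fun_prop

lemma contDiff_dispersion (hν₀ : 0 ≤ ν) (hν₁ : ν < 1) : ContDiff ℝ 4 (dispersion ν) := by
  refine ContDiff.mul ?_ (contDiff_sqrt_radicand hν₀ hν₁)
  fun_prop

lemma deriv_dispersion (hν₀ : 0 ≤ ν) (hν₁ : ν < 1) (x : ℝ) (hx : Real.sin (Real.pi * x) = 0) :
    deriv (dispersion ν) x =
      Real.pi * Real.cos (Real.pi * x) * Real.sqrt (1 - ν ^ 2 * Real.cos (Real.pi * x) ^ 2) := by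
  have h1 : HasDerivAt (fun x => Real.sin (Real.pi * x)) (Real.cos (Real.pi * x) * Real.pi) x := by
    simpa using ((hasDerivAt_id x).const_mul Real.pi).sin
  have h2 := ((contDiff_sqrt_radicand hν₀ hν₁).differentiable (by norm_num) x).hasDerivAt
  have h := (h1.mul h2).deriv
  rw [hx, zero_mul, add_zero] at h
  rw [mul_comm Real.pi, ← h]
  rfl

/-- The substitution `u = cos(πx)` reduces the integral to that of `√(1 - ν²u²)`, an elementary
arcsine integral. The division by `ν` makes `ν = 0` a separate case. -/
lemma exists_antideriv_dispersion (hν₀ : 0 ≤ ν) (hν₁ : ν < 1) :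
    ∃ G : ℝ → ℝ, (∀ x, HasDerivAt G (dispersion ν x) x) ∧
      G 1 - G 0 = kappaStar ν + (1 - ν / 2) := by
  have hpi := Real.pi_pos.ne'
  rcases hν₀.eq_or_lt with rfl | hν
  · refine ⟨fun x => -Real.cos (Real.pi * x) / Real.pi, fun x => ?_, ?_⟩
    · have h := (((hasDerivAt_id x).const_mul Real.pi).cos.neg).div_const Real.pi
      exact h.congr_deriv (by simp [dispersion, hpi])
    · simp [kappaStar]
      ring
  · set H : ℝ → ℝ := fun u => -(1 / (2 * Real.pi)) *
      (u * Real.sqrt (1 - ν ^ 2 * u ^ 2) + Real.arcsin (ν * u) / ν) with hH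
    refine ⟨fun x => H (Real.cos (Real.pi * x)), fun x => ?_, ?_⟩
    · set u := Real.cos (Real.pi * x) with hu
      have hr := radicand_pos hν₀ hν₁ u (Real.abs_cos_le_one _)
      have hs := Real.sqrt_pos.2 hr
      have hss := Real.sq_sqrt hr.le
      have h1 : HasDerivAt (fun x => Real.cos (Real.pi * x)) (-Real.sin (Real.pi * x) * Real.pi)
          x := by simpa using ((hasDerivAt_id x).const_mul Real.pi).cos
      have h2 : HasDerivAt (fun u : ℝ => 1 - ν ^ 2 * u ^ 2) (-(ν ^ 2 * (2 * u))) u := by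
        simpa using (((hasDerivAt_id u).pow 2).const_mul (ν ^ 2)).const_sub 1
      have hlt : |ν * u| < 1 := by
        rw [← sq_lt_one_iff_abs_lt_one]; nlinarith
      rw [abs_lt] at hlt
      have h3 : HasDerivAt (fun u => Real.arcsin (ν * u))
          (1 / Real.sqrt (1 - (ν * u) ^ 2) * (ν * 1)) u :=
        (Real.hasDerivAt_arcsin hlt.1.ne' hlt.2.ne).comp u ((hasDerivAt_id u).const_mul ν)
      have h4 := (((hasDerivAt_id u).mul (h2.sqrt hr.ne')).add (h3.div_const ν)).const_mul
        (-(1 / (2 * Real.pi)))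
      have h5 : HasDerivAt H _ u := h4
      refine (HasDerivAt.comp x h5 h1).congr_deriv ?_
      rw [dispersion, ← hu, mul_pow]
      simp only [id]
      set s := Real.sqrt (1 - ν ^ 2 * u ^ 2)
      field_simp
      linear_combination -Real.sin (Real.pi * x) * hss
    · have hc1 : Real.cos (Real.pi * 1) = -1 := by simp
      have hc0 : Real.cos (Real.pi * 0) = 1 := by simp
      dsimp only
      rw [hc1, hc0]
      simp only [hH, kappaStar, if_neg hν.ne', mul_neg, mul_one, Real.arcsin_neg, neg_sq, one_pow]
      field_simp
      ring

/-- The trace norm of the XY chain for the boundary condition with momentum shift `δ`. -/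
def dispersionSum (ν : ℝ) (L : ℕ) (δ : ℝ) : ℝ := ∑ q : Fin L, dispersion ν ((q + δ) / L)

theorem dispersionSum_asymptotics (hν₀ : 0 ≤ ν) (hν₁ : ν < 1) :
    ∃ C : ℝ, 0 ≤ C ∧ ∀ L : ℕ, L ≠ 0 →
      |dispersionSum ν L (1 / 2) / L - (kappaStar ν + (1 - ν / 2) +
        Real.pi * Real.sqrt (1 - ν ^ 2) / 12 / (L : ℝ) ^ 2)| ≤ C / (L : ℝ) ^ 4 ∧
      |dispersionSum ν L 0 / L - (kappaStar ν + (1 - ν / 2) -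
        Real.pi * Real.sqrt (1 - ν ^ 2) / 6 / (L : ℝ) ^ 2)| ≤ C / (L : ℝ) ^ 4 := by
  obtain ⟨G, hG, hG1⟩ := exists_antideriv_dispersion hν₀ hν₁
  have hc := contDiff_dispersion hν₀ hν₁
  have hD : ∀ n : ℕ, n < 4 → ∀ x, HasDerivAt (iteratedDeriv n (dispersion ν))
      (iteratedDeriv (n + 1) (dispersion ν) x) x := fun n hn x => by
    rw [iteratedDeriv_succ]
    exact (hc.differentiable_iteratedDeriv n (by exact_mod_cast hn) x).hasDerivAt
  have hcont : Continuous (iteratedDeriv 4 (dispersion ν)) := hc.continuous_iteratedDeriv 4 le_rfl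
  obtain ⟨C, hC⟩ := isCompact_Icc.exists_bound_of_continuousOn (s := Set.Icc (0 : ℝ) 1)
    hcont.continuousOn
  have hC0 : 0 ≤ C := (norm_nonneg _).trans (hC 0 (by simp))
  refine ⟨C, hC0, fun L hL => ?_⟩
  have h0 := hD 0 (by norm_num)
  simp only [iteratedDeriv_zero] at h0
  have hq := quadrature_le hG h0 (hD 1 (by norm_num)) (hD 2 (by norm_num)) (hD 3 (by norm_num))
    hC0 (fun x h0 h1 => hC x ⟨h0, h1⟩) (by simp [dispersion]) L hL
  have d0 : iteratedDeriv (0 + 1) (dispersion ν) 0 = Real.pi * Real.sqrt (1 - ν ^ 2) := by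
    rw [zero_add, iteratedDeriv_one, deriv_dispersion hν₀ hν₁ 0 (by simp)]; simp
  have d1 : iteratedDeriv (0 + 1) (dispersion ν) 1 = -(Real.pi * Real.sqrt (1 - ν ^ 2)) := by
    rw [zero_add, iteratedDeriv_one, deriv_dispersion hν₀ hν₁ 1 (by simp)]; simp
  rw [d0, d1, hG1] at hq
  have s1 : ∀ δ : ℝ, dispersionSum ν L δ =
      ∑ q ∈ Finset.range L, dispersion ν ((q + δ) / L) := fun δ =>
    Fin.sum_univ_eq_sum_range (fun q : ℕ => dispersion ν ((q + δ) / L)) L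
  rw [s1, s1]
  simp only [add_zero]
  constructor
  · convert hq.1 using 3
    ring
  · convert hq.2 using 3
    ring

end Dispersion

/-! ### Parity sectors and symmetrization at the critical point -/

lemma spinProd_univ_eq_pow {L : ℕ} (η : Config L) :
    spinProd Finset.univ η = (-1) ^ particleNumber η := by
  rw [particleNumber, ← Finset.prod_pow_eq_pow_sum]
  refine Finset.prod_congr rfl fun k _ => ?_
  unfold spin occ
  cases η k <;> simp

lemma spinProd_univ_of_even {L : ℕ} {η : Config L} (h : Even (particleNumber η)) :
    spinProd Finset.univ η = 1 := by rw [spinProd_univ_eq_pow, h.neg_one_pow]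

lemma spinProd_univ_of_odd {L : ℕ} {η : Config L} (h : Odd (particleNumber η)) :
    spinProd Finset.univ η = -1 := by rw [spinProd_univ_eq_pow, h.neg_one_pow]

lemma parityOp_eq_smul_iff {L : ℕ} {s : ℝ} {f : Config L → ℝ} :
    parityOp L f = s • f ↔ ∀ η, ¬ spinProd Finset.univ η = s → f η = 0 := by
  constructor
  · intro h η hη
    have h1 := congrFun h η
    rw [parityOp_apply, Pi.smul_apply, smul_eq_mul] at h1
    have h2 : (spinProd Finset.univ η - s) * f η = 0 := by linarith
    exact (mul_eq_zero.1 h2).resolve_left (sub_ne_zero.2 hη)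
  · intro h
    funext η
    rw [parityOp_apply, Pi.smul_apply, smul_eq_mul]
    by_cases hη : spinProd Finset.univ η = s
    · rw [hη]
    · rw [h η hη, mul_zero, mul_zero]

lemma exists_spinProd_univ_eq {L : ℕ} (hL : 2 ≤ L) {s : ℝ} (hs : s = 1 ∨ s = -1) :
    ∃ η : Config L, spinProd Finset.univ η = s := by
  have h0 : spinProd Finset.univ (fun _ => false : Config L) = 1 := by simp [spinProd, spin]
  rcases hs with rfl | rfl
  · exact ⟨_, h0⟩
  · refine ⟨flipAt ⟨0, by omega⟩ fun _ => false, ?_⟩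
    rw [spinProd_flipAt, h0]; simp

/-- The symmetrized tilted generator at the critical point. -/
def symGenerator (L : ℕ) (γ μ : ℝ) : Module.End ℝ (Config L → ℝ) :=
  hopping (fun k η => flip η k) (fun k η => bondRate γ k η) (exitRate μ)

lemma tiltedGenerator_eq_hopping (L : ℕ) (μ a : ℝ) (f : Config L → ℝ) (η : Config L) :
    tiltedGenerator L (1 / 2) μ a f η =
      ∑ k, (μ + 1 / 2 * a * ((occ η k : ℝ) + occ η (finRotate L k))) * f (flip η k) -
        exitRate μ η * f η := by
  rw [tiltedGenerator_apply, Finset.sum_sub_distrib, exitRate, Finset.sum_mul]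

/-- The weight `d` per particle. -/
def particleWeight (d : ℝ) (b : Bool) : ℝ := if b then d else 1

/-- The diagonal similarity transformation that symmetrizes the tilted generator. -/
def symWeight {L : ℕ} (d : ℝ) (η : Config L) : ℝ := ∏ k, particleWeight d (η k)

lemma symWeight_pos {L : ℕ} {d : ℝ} (hd : 0 < d) (η : Config L) : 0 < symWeight d η := by
  refine Finset.prod_pos fun k _ => ?_
  unfold particleWeight
  split_ifs <;> positivity

/-- This is detailed balance. A bond with 0, 1 or 2 particles has tilted rate `(1-ν)/2`, `1/2` or
`(1+ν)/2`, and its flip multiplies the weight by `d²`, `1` or `d⁻²`; the choice of `d` makes the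
outer cases both `γ/2`. -/
lemma rate_mul_symWeight_flip {L : ℕ} (hL : 2 ≤ L) {ν γ d : ℝ} (hν : ν < 1) (hd : 0 < d)
    (hγ : γ ^ 2 = 1 - ν ^ 2) (hdγ : d ^ 2 * (1 - ν) = γ) (η : Config L) (k : Fin L) :
    ((1 - ν) / 2 + 1 / 2 * ν * ((occ η k : ℝ) + occ η (finRotate L k))) * symWeight d (flip η k) =
      symWeight d η * bondRate γ k η := by
  have hne := finRotate_ne hL k
  have hg : ∀ b, particleWeight d b ≠ 0 := fun b => by
    cases b <;> simp [particleWeight, hd.ne']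
  have h1 : flipAt k η (finRotate L k) = η (finRotate L k) := by
    rw [flipAt_apply, if_neg hne]
  have hγ' : (1 + ν) = γ * d ^ 2 := by
    have : (1 - ν) * (1 + ν - γ * d ^ 2) = 0 := by linear_combination -hγ - γ * hdγ
    have := (mul_eq_zero.1 this).resolve_left (by linarith)
    linarith
  rw [flip_eq_flipAt hL, symWeight, prod_flipAt _ hg, prod_flipAt _ hg, h1]
  change _ * (_ * (_ * symWeight d η)) = _
  simp only [Finset.mem_univ, if_true, bondRate, occ]
  generalize symWeight d η = W
  cases η k <;> cases η (finRotate L k) <;> simp [particleWeight, spin]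
  · linear_combination W / 2 * hdγ
  · field_simp; ring
  · field_simp; ring
  · field_simp; linear_combination 4 * W * hγ'

/-- The limiting cumulant generating function is the largest eigenvalue of the symmetrized
generator in the sector. -/
theorem exists_isCumulantGF {L : ℕ} (hL : 2 ≤ L) {ν : ℝ} (hν₀ : 0 ≤ ν) (hν₁ : ν < 1)
    {s : ℝ} (hs : s = 1 ∨ s = -1) (sector : ℕ → Prop)
    (hsec : ∀ η : Config L, sector (particleNumber η) → spinProd Finset.univ η = s) :
    ∃ Λ : ℝ,
      IsCumulantGF L (1 / 2) ((1 - ν) / 2) (criticalPoint (1 / 2) ((1 - ν) / 2)) sector (Λ / L) ∧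
      (∀ f : Config L → ℝ, parityOp L f = s • f →
        dotProduct f (symGenerator L (Real.sqrt (1 - ν ^ 2)) ((1 - ν) / 2) f) ≤
          Λ * dotProduct f f) ∧
      ∃ φ : Config L → ℝ, 0 < dotProduct φ φ ∧ parityOp L φ = s • φ ∧
        dotProduct φ (symGenerator L (Real.sqrt (1 - ν ^ 2)) ((1 - ν) / 2) φ) =
          Λ * dotProduct φ φ := by
  set γ := Real.sqrt (1 - ν ^ 2) with hγdef
  set μ := (1 - ν) / 2 with hμ
  have hγpos : 0 < γ := Real.sqrt_pos.2 (by nlinarith)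
  have hγsq : γ ^ 2 = 1 - ν ^ 2 := Real.sq_sqrt (by nlinarith)
  obtain ⟨x₀, hx₀⟩ := exists_spinProd_univ_eq hL hs
  obtain ⟨Λ, φ, hpos, hzero, heig, hray⟩ := exists_perron_eigenvector
    (fun (k : Fin L) (η : Config L) => flip η k) (flip_involutive hL) (fun k η => bondRate γ k η)
    (bondRate_flip hL γ) (bondRate_pos hγpos) (exitRate μ) (fun η => spinProd Finset.univ η = s)
    (fun k η => by rw [spinProd_univ_flip hL]) x₀ hx₀
    (fun Z hZ x y hx hy hZx => flip_irreducible hL Z hZ x y (hx.trans hy.symm) hZx)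
  refine ⟨Λ, ?_, fun f hf => hray f (parityOp_eq_smul_iff.1 hf), φ, ?_,
    parityOp_eq_smul_iff.2 hzero, ?_⟩
  · intro η hη
    set d := Real.sqrt (γ / (1 - ν)) with hd
    have hdpos : 0 < d := Real.sqrt_pos.2 (div_pos hγpos (by linarith))
    have hdsq : d ^ 2 * (1 - ν) = γ := by
      rw [hd, Real.sq_sqrt (div_pos hγpos (by linarith)).le, div_mul_cancel₀]
      linarith
    set H := tiltedGenerator L (1 / 2) μ ν with hH
    have hexp : EReal.exp (criticalPoint (1 / 2) μ) = ENNReal.ofReal ν := by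
      rw [exp_criticalPoint, hμ]; congr 1; ring
    have hmgf := fun t => activityMGF_eq_tsum L (w := 1 / 2) (μ := μ) (a := ν) (by norm_num)
      (by rw [hμ]; linarith) hν₀ hν₁.le η _ hexp t
    simp only [hmgf]
    have hrate : ∀ (ζ : Config L) (k : Fin L),
        0 ≤ μ + 1 / 2 * ν * ((occ ζ k : ℝ) + occ ζ (finRotate L k)) := fun ζ k => by
      have : 0 ≤ μ := by rw [hμ]; linarith
      positivity
    -- Each bond has exit rate at most `μ + 1`, so the shift `L (μ + 1)` makes the generator
    -- positive. Undoing the similarity multiplies the Perron vector by the weight.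
    refine tendsto_log_semigroup H (L * (μ + 1)) ?_ (fun η => spinProd Finset.univ η = s) ?_
      (fun ζ => symWeight d ζ * φ ζ) Λ ?_ (fun ζ hζ => mul_pos (symWeight_pos hdpos ζ) (hpos ζ hζ))
      (fun ζ hζ => by rw [hzero ζ hζ, mul_zero]) η (hsec η hη) L (by exact_mod_cast (by omega))
    · intro f hf ζ
      rw [Pi.zero_apply, Pi.add_apply, hH, tiltedGenerator_eq_hopping, Pi.smul_apply, smul_eq_mul]
      have h1 : exitRate μ ζ ≤ L * (μ + 1) := by
        refine (Finset.sum_le_sum fun k _ => (?_ : _ ≤ μ + 1)).trans (le_of_eq (by simp; ring))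
        linarith [occ_le_one ζ k, occ_le_one ζ (finRotate L k)]
      have h2 : 0 ≤ ∑ k, (μ + 1 / 2 * ν * ((occ ζ k : ℝ) + occ ζ (finRotate L k))) *
          f (flip ζ k) := Finset.sum_nonneg fun k _ => mul_nonneg (hrate ζ k) (hf _)
      have h3 := mul_le_mul_of_nonneg_right h1 (hf ζ)
      linarith
    · intro f g hfg ζ hζ
      rw [hH, tiltedGenerator_eq_hopping, tiltedGenerator_eq_hopping, hfg ζ hζ]
      congr 1
      exact Finset.sum_congr rfl fun k _ => by rw [hfg _ (by rw [spinProd_univ_flip hL, hζ])]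
    · funext ζ
      have h1 := congrFun heig ζ
      rw [hopping_apply, Pi.smul_apply, smul_eq_mul] at h1
      rw [hH, tiltedGenerator_eq_hopping, Pi.smul_apply, smul_eq_mul, mul_left_comm Λ, ← h1, mul_sub,
        Finset.mul_sum]
      congr 1
      · refine Finset.sum_congr rfl fun k _ => ?_
        rw [← mul_assoc, rate_mul_symWeight_flip hL hν₁ hdpos hγsq hdsq, mul_assoc]
      · ring
  · exact Finset.sum_pos' (fun x _ => mul_self_nonneg _)
      ⟨x₀, Finset.mem_univ _, mul_pos (hpos _ hx₀) (hpos _ hx₀)⟩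
  · change dotProduct φ (hopping _ _ _ φ) = _
    rw [heig, dotProduct_smul, smul_eq_mul]

/-! ### Evaluation of the two sector eigenvalues -/

lemma bondSign_one {L : ℕ} (k : Fin L) : bondSign L 1 k = 1 := by
  unfold bondSign; split_ifs <;> rfl

lemma majoranaForm_eq_symGenerator {L : ℕ} (hL : 2 ≤ L) {σ θ : ℝ} (hσθ : σ * θ = -1) (γ μ : ℝ)
    (f : Config L → ℝ) (hf : parityOp L f = σ • f) :
    dotProduct f (majoranaForm jwA jwB (xyMatrix L γ θ) f) =
      dotProduct f (symGenerator L γ μ f) + L * (μ + 1 / 2) * dotProduct f f := by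
  rw [majoranaForm_xyMatrix hL γ μ f hf, hσθ, neg_neg, dotProduct_add, dotProduct_smul, smul_eq_mul]
  simp only [bondSign_one, one_mul]
  rfl

lemma parityOp_abs {L : ℕ} {s : ℝ} {f : Config L → ℝ} (hf : parityOp L f = s • f) :
    parityOp L |f| = s • |f| := by
  rw [parityOp_eq_smul_iff] at hf ⊢
  intro η hη
  rw [Pi.abs_apply, hf η hη, abs_zero]

/-- With the boundary condition of the other sector, the closing bond has the wrong sign; the
diamagnetic inequality removes this sign. -/
lemma majoranaForm_le_abs {L : ℕ} (hL : 2 ≤ L) {σ θ : ℝ} (hσθ : σ * θ = 1) {γ : ℝ} (hγ : 0 < γ)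
    (μ : ℝ) (f : Config L → ℝ) (hf : parityOp L f = σ • f) :
    dotProduct f (majoranaForm jwA jwB (xyMatrix L γ θ) f) ≤
      dotProduct |f| (symGenerator L γ μ |f|) + L * (μ + 1 / 2) * dotProduct f f := by
  rw [majoranaForm_xyMatrix hL γ μ f hf, hσθ, dotProduct_add, dotProduct_smul, smul_eq_mul]
  refine add_le_add_left (dotProduct_hopping_le_abs _ _ _ (fun k η => ?_) _ f) _
  rw [abs_mul, abs_of_pos (bondRate_pos hγ k η)]
  unfold bondSign
  split_ifs <;> simp

lemma dispersionSum_eq {L : ℕ} (hL : L ≠ 0) {ν γ δ : ℝ} (hγ : γ ^ 2 = 1 - ν ^ 2) (hδ0 : 0 ≤ δ)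
    (hδ1 : δ ≤ 1) : ∑ q, ‖xySymbol γ (momentum L δ q)‖ = dispersionSum ν L δ := by
  have hLpos : (0 : ℝ) < L := by exact_mod_cast Nat.pos_of_ne_zero hL
  refine Finset.sum_congr rfl fun q _ => norm_xySymbol hγ (by positivity) ?_
  rw [div_le_one hLpos]
  have : ((q : ℕ) : ℝ) + 1 ≤ L := by exact_mod_cast q.2
  linarith

/-- Criticality appears here: hopping and field cancel at momentum zero, `(1+γ)/4 + (1-γ)/4 = 1/2`.
-/
lemma sum_xyMatrix_periodic {L : ℕ} (γ : ℝ) (l : Fin L) : ∑ j, xyMatrix L γ 1 j l = 0 := by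
  have h1 : ∑ j, shiftMatrix L 1 j l = 1 := by
    rw [← Equiv.sum_comp (finRotate L).symm]
    simp only [shiftMatrix, Matrix.of_apply, bondSign_one, Equiv.apply_symm_apply]
    simp
  have h2 : ∑ j, (shiftMatrix L 1).transpose j l = 1 := by
    simp [shiftMatrix, bondSign_one]
  have h3 : ∑ j, (1 : Matrix (Fin L) (Fin L) ℝ) j l = 1 := by simp [Matrix.one_apply]
  simp only [xyMatrix, Matrix.sub_apply, Matrix.add_apply, Matrix.smul_apply, smul_eq_mul,
    Finset.sum_sub_distrib, Finset.sum_add_distrib, ← Finset.mul_sum, h1, h2, h3]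
  ring

lemma dotProduct_self_pos' {X : Type*} [Fintype X] {f : X → ℝ} (hf : f ≠ 0) :
    0 < dotProduct f f :=
  lt_of_le_of_ne (dotProduct_self_nonneg' f) fun h => hf (dotProduct_self_eq_zero.1 h.symm)

/-- Exact values of the limiting cumulant generating functions. -/
theorem exists_cumulantGF_values {L : ℕ} (hL : 2 ≤ L) {ν : ℝ} (hν₀ : 0 ≤ ν) (hν₁ : ν < 1) :
    ∃ Kp Km : ℝ,
      IsCumulantGF L (1 / 2) ((1 - ν) / 2) (criticalPoint (1 / 2) ((1 - ν) / 2)) Even Kp ∧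
      IsCumulantGF L (1 / 2) ((1 - ν) / 2) (criticalPoint (1 / 2) ((1 - ν) / 2)) Odd Km ∧
      Km = dispersionSum ν L 0 / L - (1 - ν / 2) ∧
      (dispersionSum ν L 0 < dispersionSum ν L (1 / 2) →
        Kp = dispersionSum ν L (1 / 2) / L - (1 - ν / 2)) := by
  have hL0 : L ≠ 0 := by omega
  have : NeZero L := ⟨hL0⟩
  have hLpos : (0 : ℝ) < L := by exact_mod_cast Nat.pos_of_ne_zero hL0
  obtain ⟨Λe, hKe, hRe, φe, hφe, hPe, hQe⟩ := exists_isCumulantGF hL hν₀ hν₁ (s := 1)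
    (Or.inl rfl) Even fun η => spinProd_univ_of_even
  obtain ⟨Λo, hKo, hRo, φo, hφo, hPo, hQo⟩ := exists_isCumulantGF hL hν₀ hν₁ (s := -1)
    (Or.inr rfl) Odd fun η => spinProd_univ_of_odd
  set γ := Real.sqrt (1 - ν ^ 2) with hγdef
  set μ := (1 - ν) / 2 with hμ
  have hγpos : 0 < γ := Real.sqrt_pos.2 (by nlinarith)
  have hγsq : γ ^ 2 = 1 - ν ^ 2 := Real.sq_sqrt (by nlinarith)
  have hμ' : L * (μ + 1 / 2) = L * (1 - ν / 2) := by rw [hμ]; ring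
  have hA := isMajorana_jw (L := L)
  obtain ⟨Up, Wp, Rp, hUp, hWRp, htp, hMp⟩ :=
    xyMatrix_polar (isMomenta_periodic (L := L)) hL γ
  obtain ⟨Ua, Wa, Ra, hUa, hWRa, hta, hMa⟩ :=
    xyMatrix_polar (isMomenta_antiperiodic hL0) hL γ
  rw [dispersionSum_eq hL0 hγsq le_rfl zero_le_one] at htp hMp
  rw [dispersionSum_eq hL0 hγsq (by norm_num) (by norm_num)] at hta hMa
  set Tp := dispersionSum ν L 0
  set Ta := dispersionSum ν L (1 / 2)
  have hupo : Λo + L * (1 - ν / 2) ≤ Tp := by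
    have h1 := hA.form_le Wp Rp φo
    rw [hWRp, htp, majoranaForm_eq_symGenerator hL (by norm_num) γ μ φo hPo, hQo, hμ',
      ← add_mul] at h1
    exact le_of_mul_le_mul_right h1 hφo
  have hupe : Λe + L * (1 - ν / 2) ≤ Ta := by
    have h1 := hA.form_le Wa Ra φe
    rw [hWRa, hta, majoranaForm_eq_symGenerator hL (by norm_num) γ μ φe hPe, hQe, hμ',
      ← add_mul] at h1
    exact le_of_mul_le_mul_right h1 hφe
  have hsign : ∀ f : Config L → ℝ, parityOp L f = f ∨ parityOp L f = -f →
      parityOp L f = (1 : ℝ) • f ∨ parityOp L f = (-1 : ℝ) • f := fun f hf => by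
    simpa using hf
  have hlowo : Tp ≤ Λo + L * (1 - ν / 2) := by
    obtain ⟨Ω, hΩ, hpar, hB, hval⟩ := hA.exists_form_eq Up (xyMatrix L γ 1) hUp (parityOp L)
      parityOp_mul_jwA parityOp_mul_jwB φo (by rintro rfl; simp at hφo)
      (Or.inr (by simpa using hPo))
    obtain ⟨ψ, hψ, hψP, hψv⟩ : ∃ ψ : Config L → ℝ, ψ ≠ 0 ∧ parityOp L ψ = (-1 : ℝ) • ψ ∧
        dotProduct ψ (majoranaForm jwA jwB (xyMatrix L γ 1) ψ) = Tp * dotProduct ψ ψ := by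
      -- If the vacuum is even, the normalized constant zero mode carries it to an odd vector with
      -- the same value.
      rcases hpar with hp | hp
      · obtain ⟨ψ, h1, h2, h3⟩ := hA.exists_form_eq_swap Up (xyMatrix L γ 1) hUp (parityOp L)
          parityOp_mul_jwA (fun _ => (Real.sqrt L)⁻¹)
          (by
            simp only [dotProduct, Finset.sum_const, Finset.card_univ, Fintype.card_fin,
              nsmul_eq_mul]
            rw [← mul_inv, Real.mul_self_sqrt hLpos.le, mul_inv_cancel₀ hLpos.ne'])
          (by
            funext l
            simp only [Matrix.vecMul, dotProduct, ← Finset.mul_sum, sum_xyMatrix_periodic,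
              mul_zero, Pi.zero_apply])
          Ω hΩ hB
        exact ⟨ψ, h1, by simpa using h2 hp, by rw [h3, hMp]⟩
      · exact ⟨Ω, hΩ, by simpa using hp, by rw [hval, hMp]⟩
    have h1 := hRo ψ hψP
    rw [majoranaForm_eq_symGenerator hL (by norm_num) γ μ ψ hψP, hμ'] at hψv
    refine le_of_mul_le_mul_right ?_ (dotProduct_self_pos' hψ)
    rw [← hψv, add_mul]
    linarith
  refine ⟨Λe / L, Λo / L, hKe, hKo, ?_, fun hlt => ?_⟩
  · have : Λo = Tp - L * (1 - ν / 2) := by linarith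
    rw [this]; field_simp
  · have hlowe : Ta ≤ Λe + L * (1 - ν / 2) := by
      obtain ⟨Ω, hΩ, hpar, hB, hval⟩ := hA.exists_form_eq Ua (xyMatrix L γ (-1)) hUa (parityOp L)
        parityOp_mul_jwA parityOp_mul_jwB φe (by rintro rfl; simp at hφe)
        (Or.inl (by simpa using hPe))
      rw [hMa] at hval
      have hΩp := dotProduct_self_pos' hΩ
      rcases hsign Ω hpar with hp | hp
      · have h1 := hRe Ω hp
        rw [majoranaForm_eq_symGenerator hL (by norm_num) γ μ Ω hp, hμ'] at hval
        refine le_of_mul_le_mul_right ?_ hΩp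
        rw [← hval, add_mul]
        linarith
      -- An odd antiperiodic maximizer would give `Ta ≤ Λo + L (1 - ν/2) ≤ Tp`, against the assumed
      -- strict inequality.
      · exfalso
        have h1 := majoranaForm_le_abs hL (σ := -1) (θ := -1) (by norm_num) hγpos μ Ω hp
        have h2 := hRo |Ω| (parityOp_abs hp)
        rw [dotProduct_abs_self] at h2
        rw [hval, hμ'] at h1
        have h3 : Ta * dotProduct Ω Ω ≤ (Λo + L * (1 - ν / 2)) * dotProduct Ω Ω := by
          rw [add_mul]; linarith
        have h4 := le_of_mul_le_mul_right h3 hΩp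
        linarith
    have : Λe = Ta - L * (1 - ν / 2) := by linarith
    rw [this]; field_simp

/-! ### The endpoint `ν = 1` and the large-`L` expansion -/

/-- At `ν = 1` the process is not tilted. -/
lemma isCumulantGF_of_nu_one (L : ℕ) (sector : ℕ → Prop) :
    IsCumulantGF L (1 / 2) ((1 - 1) / 2) (criticalPoint (1 / 2) ((1 - 1) / 2)) sector 0 := by
  intro η _
  have hexp : EReal.exp (criticalPoint (1 / 2) ((1 - 1) / 2)) = ENNReal.ofReal 1 := by
    rw [exp_criticalPoint]; congr 1; ring
  have hmgf := fun t => activityMGF_eq_tsum L (w := 1 / 2) (μ := (1 - 1) / 2) (a := 1)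
    (by norm_num) (by norm_num) zero_le_one le_rfl η _ hexp t
  -- Constants lie in the kernel by conservation of probability, so the moment generating function
  -- is identically `1`.
  have h0 : tiltedGenerator L (1 / 2) ((1 - 1) / 2) 1 (fun _ => 1) = (0 : ℝ) • fun _ => 1 := by
    funext ζ
    rw [tiltedGenerator_apply]
    simp
  simp only [hmgf, tsum_exp_eigenvector _ _ _ _ h0]
  simp

lemma kappaStar_one : kappaStar 1 = 0 := by
  have := Real.pi_pos.ne'
  simp [kappaStar]
  field_simp
  norm_num

lemma eventually_dispersionSum_lt {ν : ℝ} (hν₀ : 0 ≤ ν) (hν₁ : ν < 1) :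
    ∀ᶠ L : ℕ in atTop, dispersionSum ν L 0 < dispersionSum ν L (1 / 2) := by
  obtain ⟨C, hC0, hC⟩ := dispersionSum_asymptotics hν₀ hν₁
  set e := Real.pi * Real.sqrt (1 - ν ^ 2) with he
  have hepos : 0 < e := mul_pos Real.pi_pos (Real.sqrt_pos.2 (by nlinarith))
  -- The two `L⁻²` terms are separated by `e/(4L²)`, which must beat the errors `2C/L⁴`, that is `8C
  -- < eL²`; as `L ≥ 1`, `L > 8C/e` suffices.
  have hlarge : ∀ᶠ L : ℕ in atTop, 8 * C / e < (L : ℝ) :=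
    tendsto_natCast_atTop_atTop.eventually_gt_atTop _
  filter_upwards [hlarge, eventually_ge_atTop 1] with L hL1 hL2
  have hLge : (1 : ℝ) ≤ L := by exact_mod_cast hL2
  have hLpos : (0 : ℝ) < L := by linarith
  obtain ⟨h1, h2⟩ := hC L (by omega)
  rw [abs_le] at h1 h2
  have h3 : dispersionSum ν L 0 / L < dispersionSum ν L (1 / 2) / L := by
    have hlt : 2 * (C / (L : ℝ) ^ 4) < e / 4 / (L : ℝ) ^ 2 := by
      rw [div_lt_iff₀ hepos] at hL1
      have : 8 * C < (L : ℝ) ^ 2 * e := by nlinarith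
      rw [← mul_div_assoc, div_lt_div_iff₀ (by positivity) (by positivity)]
      have hL2pos : (0 : ℝ) < (L : ℝ) ^ 2 := by positivity
      nlinarith
    have : e / 4 / (L : ℝ) ^ 2 = e / 12 / (L : ℝ) ^ 2 + e / 6 / (L : ℝ) ^ 2 := by ring
    linarith
  exact (div_lt_div_iff_of_pos_right hLpos).1 h3

end

end DLPAD

theorem mainTheorem3 (ν : ℝ) (hν₀ : 0 ≤ ν) (hν₁ : ν ≤ 1) :
    ∃ Kplus Kminus : ℕ → ℝ,
      (∀ L : ℕ, 2 ≤ L →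
        DLPAD.IsCumulantGF L (1 / 2) ((1 - ν) / 2)
            (DLPAD.criticalPoint (1 / 2) ((1 - ν) / 2)) Even (Kplus L) ∧
        DLPAD.IsCumulantGF L (1 / 2) ((1 - ν) / 2)
            (DLPAD.criticalPoint (1 / 2) ((1 - ν) / 2)) Odd (Kminus L)) ∧
      (fun L : ℕ => Kplus L -
          (DLPAD.kappaStar ν +
            1 / DLPAD.soundVelocity ν * (Real.pi * DLPAD.centralCharge / (6 * (L : ℝ) ^ 2))))
        =O[atTop] (fun L : ℕ => ((L : ℝ) ^ 4)⁻¹) ∧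
      (fun L : ℕ => Kminus L -
          (DLPAD.kappaStar ν -
            1 / DLPAD.soundVelocity ν * (Real.pi * DLPAD.centralCharge / (3 * (L : ℝ) ^ 2))))
        =O[atTop] (fun L : ℕ => ((L : ℝ) ^ 3)⁻¹) := by
  rcases hν₁.eq_or_lt with rfl | hν₁
  · refine ⟨fun _ => 0, fun _ => 0, fun L _ => ⟨DLPAD.isCumulantGF_of_nu_one L _,
      DLPAD.isCumulantGF_of_nu_one L _⟩, ?_, ?_⟩
    · simpa [DLPAD.kappaStar_one, DLPAD.soundVelocity] using isBigO_zero _ _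
    · simpa [DLPAD.kappaStar_one, DLPAD.soundVelocity] using isBigO_zero _ _
  -- The values at `L < 2` are arbitrary. The even limit exists for every `L ≥ 2`, while its closed
  -- form is claimed only when the two sums are strictly ordered.
  · have hex : ∀ L : ℕ, ∃ Kp Km : ℝ, 2 ≤ L →
        DLPAD.IsCumulantGF L (1 / 2) ((1 - ν) / 2)
          (DLPAD.criticalPoint (1 / 2) ((1 - ν) / 2)) Even Kp ∧
        DLPAD.IsCumulantGF L (1 / 2) ((1 - ν) / 2)
          (DLPAD.criticalPoint (1 / 2) ((1 - ν) / 2)) Odd Km ∧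
        Km = DLPAD.dispersionSum ν L 0 / L - (1 - ν / 2) ∧
        (DLPAD.dispersionSum ν L 0 < DLPAD.dispersionSum ν L (1 / 2) →
          Kp = DLPAD.dispersionSum ν L (1 / 2) / L - (1 - ν / 2)) := fun L => by
      by_cases hL : 2 ≤ L
      · obtain ⟨Kp, Km, h⟩ := DLPAD.exists_cumulantGF_values hL hν₀ hν₁
        exact ⟨Kp, Km, fun _ => h⟩
      · exact ⟨0, 0, fun h => absurd h hL⟩
    choose Kp Km hK using hex
    obtain ⟨C, hC0, hC⟩ := DLPAD.dispersionSum_asymptotics hν₀ hν₁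
    refine ⟨Kp, Km, fun L hL => ⟨(hK L hL).1, (hK L hL).2.1⟩, IsBigO.of_bound C ?_,
      IsBigO.of_bound C ?_⟩
    · filter_upwards [DLPAD.eventually_dispersionSum_lt hν₀ hν₁, eventually_ge_atTop 2]
        with L hlt hL
      rw [(hK L hL).2.2.2 hlt, Real.norm_eq_abs, norm_inv, Real.norm_of_nonneg (by positivity),
        ← div_eq_mul_inv]
      refine le_trans (le_of_eq ?_) (hC L (by omega)).1
      rw [DLPAD.soundVelocity, one_div_one_div, DLPAD.centralCharge]
      congr 1
      ring
    · filter_upwards [eventually_ge_atTop 2] with L hL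
      have hL1 : (1 : ℝ) ≤ L := by exact_mod_cast (by omega : 1 ≤ L)
      rw [(hK L hL).2.2.1, Real.norm_eq_abs, norm_inv, Real.norm_of_nonneg (by positivity),
        ← div_eq_mul_inv]
      -- The trapezoidal error is in fact of fourth order and is weakened to third order.
      have h4 : C / (L : ℝ) ^ 4 ≤ C / (L : ℝ) ^ 3 := by
        gcongr
        norm_num
      refine le_trans (le_of_eq ?_) ((hC L (by omega)).2.trans h4)
      rw [DLPAD.soundVelocity, one_div_one_div, DLPAD.centralCharge]
      congr 1
      ring
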